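/- Let $p>2$ be a prime, $F$ a finite extension of $\mathbb Q_p$, and $E/F$ an unramified quadratic field extension with nontrivial automorphism $x\mapsto\bar x$. Let $\varpi$ be a uniformizer of $\mathcal O_F$, $q=|\mathcal O_F/\varpi|$, $v$ the valuation on $E$ (and on $F$) with $v(\varpi)=1$ and $v(0)=\infty$, $|x|_F=q^{-v(x)}$, and $\eta(x)=(-1)^{v(x)}$ for $x\in F^\times$. Let $S_2(F)=\{g\in \mathrm{GL}_2(E): g\bar g=1\}$ and $V_2'(F)=F^2\times(F^2)^\vee$ (column vectors and row vectors). For an integer $r\ge 0$ put $K'_{S,\le r}=S_2(F)\cap\varpi^{-r}\mathrm{Mat}_2(\mathcal O_E)$. A triple $(A,\mathbf u,\mathbf v^\top)$, with $A\in\mathrm{Mat}_2(E)$ and $\mathbf u$, $\mathbf v^\top$ a column and a row vector over $E$, is called regular semisimple if $(\mathbf u,A\mathbf u)$ and $(\mathbf v^\top,\mathbf v^\top A)$ are bases of $E^2$. Let $(S_2(F)\times V_2'(F))_{\mathrm{rs}}^-$ be the set of regular semisimple $(\gamma,\mathbf u,\mathbf v^\top)\in S_2(F)\times V_2'(F)$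 that match an element of the nonsplit unitary group, i.e. for which there are a nonsplit $2$-dimensional $E/F$-Hermitian space $\mathbb V$ (nondegenerate, and not isometric to $E^2$ with the form $\bar x_1y_2+\bar x_2y_1$), an element $g\in \mathrm U(\mathbb V)$ and a vector $w\in\mathbb V$ such that $(g,w,w^*)$ is regular semisimple and $\begin{pmatrix}\gamma&\mathbf u\\ \mathbf v^\top&0\end{pmatrix}$ and $\begin{pmatrix}g&w\\ w^*&0\end{pmatrix}$ are conjugate under $\mathrm{GL}_2(E)$ (embedded as $\mathrm{diag}(h,1)$), where $w^*=\langle w,\cdot\rangle$. For $(\gamma,\mathbf u,\mathbf v^\top)\in S_2(F)\times V'_2(F)$, $\phi:S_2(F)\to\mathbb C$ and $s\in\mathbb C$ let $$\mathrm{Orb}((\gamma,\mathbf u,\mathbf v^\top),\phi\otimes\mathbf 1,s)=\int_{h\in\mathrm{GL}_2(F)}\phi(h\gamma h^{-1})\,\mathbf 1_{\mathcal O_F^2\times(\mathcal O_F^2)^\vee}(h\mathbf u,\mathbf v^\top h^{-1})\,\eta(\det h)\,|\det h|_F^{-s}\,dh,$$ where $dh$ is the Haar measure giving $\mathrm{GL}_2(\mathcal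 O_F)$ volume $1$. **Theorem.** Let $a,b,c,d\in E$ and $e\in F$ be such that $$(\gamma,\mathbf u,\mathbf v^\top)=\left(\begin{pmatrix}a&b\\c&d\end{pmatrix},\begin{pmatrix}0\\1\end{pmatrix},\begin{pmatrix}0&e\end{pmatrix}\right)\in(S_2(F)\times V_2'(F))_{\mathrm{rs}}^-,$$ and let $r\ge0$ be an integer. Then the integral defining $\mathrm{Orb}(s):=\mathrm{Orb}((\gamma,\mathbf u,\mathbf v^\top),\mathbf 1_{K'_{S,\le r}}\otimes\mathbf 1,s)$ converges absolutely for every $s\in\mathbb C$, and the following hold. (1) If $v(e)<0$ or $v(b)+v(c)<-2r$, then $\mathrm{Orb}(s)=0$ for all $s\in\mathbb C$. (2) Otherwise put $N=\min\left(v(e),\ \tfrac{v(b)+v(c)-1}{2}+r,\ v(d-a)+r\right)$ and $$\mathbf n(k)=\min\left(\left\lfloor\tfrac{k+(v(b)+r)}2\right\rfloor,\ \left\lfloor\tfrac{(2v(e)+v(c)+r)-k}2\right\rfloor,\ N\right).$$ If $v(d-a)<v(e)-r$ and $v(b)+v(c)>2v(d-a)$, put $$\mathbf c(k)=\min\big(k-(2v(d-a)-v(b)+r),\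 (2v(e)+v(c)-2v(d-a)-r)-k,\ v(e)-v(d-a)-r\big);$$ otherwise put $\mathbf c(k)=0$. Then for all $s\in\mathbb C$ $$\mathrm{Orb}(s)=\sum_{k=-(v(b)+r)}^{2v(e)+v(c)+r}(-1)^k\left(1+q+\dots+q^{\mathbf n(k)}\right)(q^s)^k+\sum_{k=2v(d-a)-v(b)+r}^{2v(e)+v(c)-2v(d-a)-r}(-1)^k\,\mathbf c(k)\,q^{v(d-a)+r}(q^s)^k,$$ where the second sum is understood to be $0$ when $\mathbf c$ is identically $0$ (in particular when $d=a$). -/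

import Mathlib

open MeasureTheory
open scoped Matrix MatrixGroups

namespace SemiLie

noncomputable section

/-! ### Local fields -/

/-- The ring of integers `{x | ‖x‖ ≤ 1}` of a finite extension `K` of `ℚ_p`, where the norm of `K`
is the (unique) multiplicative norm extending the `p`-adic one. -/
def ringOfIntegers (p : ℕ) [Fact p.Prime] (K : Type*) [NormedField K] [NormedAlgebra ℚ_[p] K] :
    Subring K where
  carrier := {x | ‖x‖ ≤ 1}
  mul_mem' {x y} hx hy := by
    simp only [Set.mem_ofPred_eq] at hx hy ⊢
    rw [norm_mul]
    exact mul_le_one₀ hx (norm_nonneg y) hy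
  one_mem' := by simp
  add_mem' {x y} hx hy := by
    have := IsUltrametricDist.of_normedAlgebra (L := K) ℚ_[p]
    exact (IsUltrametricDist.norm_add_le_max x y).trans (max_le hx hy)
  zero_mem' := by simp
  neg_mem' {x} hx := by simpa using! hx

/-- The cardinality `q = |𝒪_F / ϖ|` of the residue field. -/
def residueCard (p : ℕ) [Fact p.Prime] (F : Type*) [NormedField F] [NormedAlgebra ℚ_[p] F]
    (ϖ : ringOfIntegers p F) : ℕ :=
  Nat.card (ringOfIntegers p F ⧸ Ideal.span {ϖ})

/-- The extension `E/F` is unramified: the two fields have the same value group (ramification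
index one; residue fields of `p`-adic fields are finite, so residue extensions are separable). -/
def IsUnramifiedExtension (F E : Type*) [NormedField F] [NormedField E] : Prop :=
  ∀ x : E, ∃ y : F, ‖x‖ = ‖y‖

/-- The valuation `v(x)` of a nonzero element `x` of `K`, for `K = F` or `K = E`: the largest
integer `n` with `x ∈ ϖ ^ n 𝒪_K`. (Its value at `x = 0` is irrelevant.) -/
def ord {F : Type*} [NormedField F] (ϖ : F) {K : Type*} [NormedField K] (x : K) : ℤ :=
  sSup {n : ℤ | ‖x‖ ≤ ‖ϖ‖ ^ n}

/-- The valuation with values in `ℤ ∪ {∞}`, where `v(0) = ∞`. -/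
def val {F : Type*} [NormedField F] (ϖ : F) {K : Type*} [NormedField K] (x : K) : WithTop ℤ :=
  open scoped Classical in if x = 0 then ⊤ else ((ord ϖ x : ℤ) : WithTop ℤ)

theorem ord_eq {F : Type*} [NormedField F] {ϖ : F} (h0 : ϖ ≠ 0) (h1 : ‖ϖ‖ < 1)
    {K : Type*} [NormedField K] {x : K} {n : ℤ} (hx : ‖x‖ = ‖ϖ‖ ^ n) : ord ϖ x = n := by
  have hpos : 0 < ‖ϖ‖ := norm_pos_iff.mpr h0
  have : {m : ℤ | ‖x‖ ≤ ‖ϖ‖ ^ m} = Set.Iic n := by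
    ext m
    simp only [Set.mem_ofPred_eq, Set.mem_Iic, hx]
    exact zpow_le_zpow_iff_right_of_lt_one₀ hpos h1
  rw [ord, this, csSup_Iic]

/-- The normalized absolute value `|x|_F = q ^ (-v(x))`. -/
def normalizedAbs {F : Type*} [NormedField F] (q : ℕ) (ϖ : F) (x : F) : ℝ :=
  open scoped Classical in if x = 0 then 0 else (q : ℝ) ^ (-ord ϖ x)

/-- The unramified quadratic character `η(x) = (-1) ^ v(x)` on nonzero `x`. -/
def eta {F : Type*} [NormedField F] (ϖ : F) (x : F) : ℂ := (-1 : ℂ) ^ ord ϖ x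

/-! ### The symmetric space, regular semisimplicity, Hermitian spaces and matching -/

section Spaces

variable {F E : Type*} [NormedField F] [NormedField E] [NormedAlgebra F E] {n : ℕ}

/-- `S_n(F) = {g ∈ GL_n(E) | g ḡ = 1}`; the equation already forces `g` to be invertible. -/
def symmetricSpace (σ : E ≃ₐ[F] E) (n : ℕ) : Set (Matrix (Fin n) (Fin n) E) :=
  {g | g * g.map σ = 1}

/-- The part `S_n(F) ∩ ϖ ^ (-r) Mat_n(𝒪_E)` of the symmetric space. -/
def symmetricSpaceLE (σ : E ≃ₐ[F] E) (n : ℕ) (ϖ : F) (r : ℕ) : Set (Matrix (Fin n) (Fin n) E) :=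
  {g | g ∈ symmetricSpace σ n ∧ ∀ i j, ‖g i j‖ ≤ ‖ϖ‖ ^ (-(r : ℤ))}

/-- A triple (square matrix, column vector, row vector) over `E` is regular semisimple: the vectors
`u, Au, …, A^(n-1)u` form a basis of `E^n` and so do `v, vA, …, vA^(n-1)`. -/
def IsRegularSemisimple (A : Matrix (Fin n) (Fin n) E) (u v : Fin n → E) : Prop :=
  LinearIndependent E (fun i : Fin n => (A ^ (i : ℕ)) *ᵥ u) ∧
    LinearIndependent E (fun i : Fin n => v ᵥ* (A ^ (i : ℕ)))

/-- Two triples are conjugate under `GL_n(E)`, i.e. the matrices `[[A, u], [v, 0]]` and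
`[[A', u'], [v', 0]]` are conjugate by a block matrix `diag(h, 1)`. -/
def AreConjugate (A : Matrix (Fin n) (Fin n) E) (u v : Fin n → E)
    (A' : Matrix (Fin n) (Fin n) E) (u' v' : Fin n → E) : Prop :=
  ∃ h : GL (Fin n) E,
    (h : Matrix (Fin n) (Fin n) E) * A * ((h⁻¹ : GL (Fin n) E) : Matrix (Fin n) (Fin n) E) = A' ∧
    (h : Matrix (Fin n) (Fin n) E) *ᵥ u = u' ∧
    v ᵥ* ((h⁻¹ : GL (Fin n) E) : Matrix (Fin n) (Fin n) E) = v'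

/-- The conjugate transpose with respect to `σ`. -/
def conjTr (σ : E ≃ₐ[F] E) (A : Matrix (Fin n) (Fin n) E) : Matrix (Fin n) (Fin n) E :=
  (A.map σ)ᵀ

/-- The antidiagonal matrix, the Gram matrix of the split Hermitian space of dimension `n`. -/
def antidiagonal (E : Type*) [NormedField E] (n : ℕ) : Matrix (Fin n) (Fin n) E :=
  Matrix.of fun i j => if j = Fin.rev i then 1 else 0

/-- `J` is the Gram matrix of a nondegenerate Hermitian form `⟨x, y⟩ = x^* J y` on `E^n` that is
not split, i.e. not isometric to the one given by the antidiagonal matrix. -/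
def IsNonsplitHermitian (σ : E ≃ₐ[F] E) (J : Matrix (Fin n) (Fin n) E) : Prop :=
  conjTr σ J = J ∧ J.det ≠ 0 ∧
    ¬ ∃ P : GL (Fin n) E, conjTr σ (P : Matrix (Fin n) (Fin n) E) * J * P = antidiagonal E n

/-- The locus of those `(γ, u, v) ∈ S_n(F) × F^n × (F^n)^∨` that are regular semisimple and match
a regular semisimple pair `(g, w)`, where `g` is in the unitary group of a nonsplit `n`-dimensional
Hermitian space and `w` is a vector of that space: `[[γ, u], [v, 0]]` is conjugate under `GL_n(E)`
to `[[g, w], [w^*, 0]]`, where `w^* = ⟨w, ·⟩` is the row vector of the functional. -/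
def minusLocus (σ : E ≃ₐ[F] E) (n : ℕ) :
    Set (Matrix (Fin n) (Fin n) E × (Fin n → F) × (Fin n → F)) :=
  {x | x.1 ∈ symmetricSpace σ n ∧
    IsRegularSemisimple x.1 (algebraMap F E ∘ x.2.1) (algebraMap F E ∘ x.2.2) ∧
    ∃ J : Matrix (Fin n) (Fin n) E, IsNonsplitHermitian σ J ∧
    ∃ (g : Matrix (Fin n) (Fin n) E) (w : Fin n → E),
      conjTr σ g * J * g = J ∧
      IsRegularSemisimple g w ((σ ∘ w) ᵥ* J) ∧
      AreConjugate x.1 (algebraMap F E ∘ x.2.1) (algebraMap F E ∘ x.2.2) g w ((σ ∘ w) ᵥ* J)}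

/-! ### The weighted orbital integral -/

/-- The subgroup `GL_n(𝒪_F)` of `GL_n(F)`, as a set. -/
def integralGL (F : Type*) [NormedField F] (n : ℕ) : Set (GL (Fin n) F) :=
  {h | (∀ i j, ‖(h : Matrix (Fin n) (Fin n) F) i j‖ ≤ 1) ∧
    ‖(h : Matrix (Fin n) (Fin n) F).det‖ = 1}

/-- The indicator function of `𝒪_F^n × (𝒪_F^n)^∨`. -/
def integralIndicator (u v : Fin n → F) : ℂ :=
  open scoped Classical in if (∀ i, ‖u i‖ ≤ 1) ∧ (∀ i, ‖v i‖ ≤ 1) then 1 else 0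

/-- The integrand `φ(h γ h⁻¹) 1(h u, v h⁻¹) η(det h) |det h|_F ^ (-s)`. -/
def orbIntegrand (q : ℕ) (ϖ : F) (φ : Matrix (Fin n) (Fin n) E → ℂ)
    (x : Matrix (Fin n) (Fin n) E × (Fin n → F) × (Fin n → F)) (s : ℂ) (h : GL (Fin n) F) : ℂ :=
  φ ((h : Matrix (Fin n) (Fin n) F).map (algebraMap F E) * x.1 *
      ((h⁻¹ : GL (Fin n) F) : Matrix (Fin n) (Fin n) F).map (algebraMap F E)) *
    integralIndicator ((h : Matrix (Fin n) (Fin n) F) *ᵥ x.2.1)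
      (x.2.2 ᵥ* ((h⁻¹ : GL (Fin n) F) : Matrix (Fin n) (Fin n) F)) *
    eta ϖ (h : Matrix (Fin n) (Fin n) F).det *
    ((normalizedAbs q ϖ (h : Matrix (Fin n) (Fin n) F).det : ℝ) : ℂ) ^ (-s)

/-- The weighted orbital integral `Orb(x, φ ⊗ 1, s)`, with respect to the measure `μ` on
`GL_n(F)`. -/
def orb [MeasurableSpace (GL (Fin n) F)] (μ : Measure (GL (Fin n) F)) (q : ℕ) (ϖ : F)
    (φ : Matrix (Fin n) (Fin n) E → ℂ)
    (x : Matrix (Fin n) (Fin n) E × (Fin n → F) × (Fin n → F)) (s : ℂ) : ℂ :=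
  ∫ h, orbIntegrand q ϖ φ x s h ∂μ

end Spaces

/-! ### The explicit formula

Here `vb, vc, ve` stand for the valuations of `b, c, e`, and `δ ∈ ℤ ∪ {∞}` for that of `d - a`.
Division by `2` of integers is division rounded down. -/

/-- `N = min (v(e), (v(b) + v(c) - 1) / 2 + r, v(d - a) + r)`. -/
def bigN (vb vc ve : ℤ) (r : ℤ) : WithTop ℤ → ℤ
  | ⊤ => min ve ((vb + vc - 1) / 2 + r)
  | (δ : ℤ) => min ve (min ((vb + vc - 1) / 2 + r) (δ + r))

/-- The function `n(k)`. -/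
def nFun (vb vc ve : ℤ) (δ : WithTop ℤ) (r : ℤ) (k : ℤ) : ℤ :=
  min ((k + (vb + r)) / 2) (min (((2 * ve + vc + r) - k) / 2) (bigN vb vc ve r δ))

/-- The function `c(k)`, for finite `δ`. -/
def cFun (vb vc ve δ r k : ℤ) : ℤ :=
  if δ < ve - r ∧ vb + vc > 2 * δ then
    min (k - (2 * δ - vb + r)) (min ((2 * ve + vc - 2 * δ - r) - k) (ve - δ - r))
  else 0

/-- The sum of `(-1)^k (1 + q + ⋯ + q^(n(k))) (q^s)^k` over
`-(v(b) + r) ≤ k ≤ 2v(e) + v(c) + r`. -/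
def mainSum (q : ℕ) (vb vc ve : ℤ) (δ : WithTop ℤ) (r : ℤ) (s : ℂ) : ℂ :=
  ∑ k ∈ Finset.Icc (-(vb + r)) (2 * ve + vc + r),
    (-1 : ℂ) ^ k * (∑ j ∈ Finset.Icc 0 (nFun vb vc ve δ r k), (q : ℂ) ^ j) * ((q : ℂ) ^ s) ^ k

/-- The sum of `(-1)^k c(k) q^(v(d-a) + r) (q^s)^k` over
`2v(d-a) - v(b) + r ≤ k ≤ 2v(e) + v(c) - 2v(d-a) - r`; it is absent when `d = a`, since then
`c` is the zero function. -/
def extraSum (q : ℕ) (vb vc ve : ℤ) (r : ℤ) (s : ℂ) : WithTop ℤ → ℂ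
  | ⊤ => 0
  | (δ : ℤ) => ∑ k ∈ Finset.Icc (2 * δ - vb + r) (2 * ve + vc - 2 * δ - r),
      (-1 : ℂ) ^ k * (cFun vb vc ve δ r k : ℂ) * (q : ℂ) ^ (δ + r) * ((q : ℂ) ^ s) ^ k

end

end SemiLie

namespace SemiLie

/-! The integrand is left invariant under K = GL_2(𝒪_F), so the integral is a sum over K\GL_2(F). By
the Iwasawa decomposition each coset contains some [[ϖ^m, t], [0, ϖ^n]], with t determined modulo
ϖ^n 𝒪_F, and each coset has measure 1 because upper triangular matrices have trivial modular
character.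

Membership in the minus locus enters through the Hermitian form pulled back to the coordinates of γ:
it is diag(f, e) with f b = e c, so nonsplitness says that -c σ(b) is not a norm
(`mul_conj_ne_of_mem_minusLocus`). As elements of even valuation are norms, v(b) + v(c) is odd. The
equations of S_2 then make v(b) + v(c) positive and d - a integral, and give c = bC, d - a = bD with
C, D in F (`exists_valuations_of_mem_minusLocus`).

On S_2 the off-diagonal entries control the diagonal ones. At a representative the integrand is
therefore (-1)^k (q^s)^k, with k = m + n, if t is integral, 0 ≤ n ≤ v(e), m ≤ n + v(c) + r and |ϖ^m
+ tD - t²Cϖ^(-m)| ≤ |ϖ|^(n-r-v(b)); otherwise it is 0 (`orbIntegrand_rep`). Only finitely many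
cosets contribute, whence absolute convergence for all s, and it remains to count t modulo ϖ^n
(`orb_eq_sum_ncard`).

If 2v(d-a) > v(b) + v(c), or d = a, the outer terms of the quadratic have valuations of different
parity and the middle one never dominates, so the solutions form one ball about 0 or none exist
(`IsUniformizer.ncard_quadratic_of_lt`). If 2v(d-a) < v(b) + v(c), the discriminant is a square, the
quadratic splits over F, and for large n the solutions are balls about its two roots, each having
q^(v(d-a)+r) classes (`IsUniformizer.ncard_quadratic_of_gt`). Summing over n for fixed k gives 1 + q
+ … + q^n(k); in the second case the surplus balls give c(k) q^(v(d-a)+r) (`sum_zpow_eq_of_lt`,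
`sum_zpow_eq_of_gt`). -/

/-- A uniformizer of a discretely valued field. -/
structure IsUniformizer {F : Type*} [NormedField F] (ϖ : F) : Prop where
  ne_zero : ϖ ≠ 0
  norm_lt_one : ‖ϖ‖ < 1
  exists_zpow : ∀ x : F, x ≠ 0 → ∃ n : ℤ, ‖x‖ = ‖ϖ‖ ^ n

theorem norm_sub_le_max_of_ultrametric {F : Type*} [NormedField F] [IsUltrametricDist F] (x y : F) :
    ‖x - y‖ ≤ max ‖x‖ ‖y‖ := by
  rw [sub_eq_add_neg, ← norm_neg y]
  exact IsUltrametricDist.norm_add_le_max x (-y)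

/-! ### Fractional ideals, their indices, and square roots near 1. -/

section Uniformizer

variable {F : Type*} [NormedField F] {ϖ : F}

theorem IsUniformizer.norm_pos (h : IsUniformizer ϖ) : 0 < ‖ϖ‖ := norm_pos_iff.mpr h.ne_zero

theorem IsUniformizer.zpow_le_zpow (h : IsUniformizer ϖ) {m n : ℤ} :
    ‖ϖ‖ ^ m ≤ ‖ϖ‖ ^ n ↔ n ≤ m :=
  zpow_le_zpow_iff_right_of_lt_one₀ h.norm_pos h.norm_lt_one

theorem IsUniformizer.zpow_lt_zpow (h : IsUniformizer ϖ) {m n : ℤ} :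
    ‖ϖ‖ ^ m < ‖ϖ‖ ^ n ↔ n < m :=
  zpow_lt_zpow_iff_right_of_lt_one₀ h.norm_pos h.norm_lt_one

theorem IsUniformizer.zpow_inj (h : IsUniformizer ϖ) {m n : ℤ} :
    ‖ϖ‖ ^ m = ‖ϖ‖ ^ n ↔ m = n := by
  constructor
  · intro e
    exact le_antisymm (h.zpow_le_zpow.mp e.ge) (h.zpow_le_zpow.mp e.le)
  · rintro rfl
    rfl

theorem IsUniformizer.zpow_le_one (h : IsUniformizer ϖ) {m : ℤ} : ‖ϖ‖ ^ m ≤ 1 ↔ 0 ≤ m := by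
  rw [← h.zpow_le_zpow, zpow_zero]

theorem IsUniformizer.norm_eq_ord (h : IsUniformizer ϖ) {K : Type*} [NormedField K] {x : K}
    {n : ℤ} (hx : ‖x‖ = ‖ϖ‖ ^ n) : ‖x‖ = ‖ϖ‖ ^ ord ϖ x := by
  rw [ord_eq h.ne_zero h.norm_lt_one hx, hx]

theorem IsUniformizer.norm_le_of_lt (h : IsUniformizer ϖ) {x : F} {n : ℤ}
    (hx : ‖x‖ < ‖ϖ‖ ^ n) : ‖x‖ ≤ ‖ϖ‖ ^ (n + 1) := by
  by_cases h0 : x = 0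
  · rw [h0, norm_zero]
    exact zpow_nonneg (norm_nonneg _) _
  · obtain ⟨m, hm⟩ := h.exists_zpow x h0
    rw [hm, h.zpow_lt_zpow] at hx
    rw [hm, h.zpow_le_zpow]
    omega

variable [IsUltrametricDist F]

/-- The fractional ideal `ϖ ^ n 𝒪_F`. -/
def fracIdeal (ϖ : F) (n : ℤ) : AddSubgroup F where
  carrier := {x | ‖x‖ ≤ ‖ϖ‖ ^ n}
  add_mem' {x y} hx hy := (IsUltrametricDist.norm_add_le_max x y).trans (max_le hx hy)
  zero_mem' := by simpa using zpow_nonneg (norm_nonneg ϖ) n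
  neg_mem' {x} hx := by simpa using hx

theorem mem_fracIdeal {n : ℤ} {x : F} : x ∈ fracIdeal ϖ n ↔ ‖x‖ ≤ ‖ϖ‖ ^ n := Iff.rfl

theorem IsUniformizer.fracIdeal_le (h : IsUniformizer ϖ) {m n : ℤ} (hmn : m ≤ n) :
    fracIdeal ϖ n ≤ fracIdeal ϖ m :=
  fun _ hx => le_trans hx (h.zpow_le_zpow.mpr hmn)

theorem IsUniformizer.map_mulLeft_fracIdeal (h : IsUniformizer ϖ) (m n : ℤ) :
    (fracIdeal ϖ n).map (AddMonoidHom.mulLeft (ϖ ^ m)) = fracIdeal ϖ (m + n) := by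
  have hp := h.norm_pos
  ext x
  simp only [AddSubgroup.mem_map, mem_fracIdeal, AddMonoidHom.coe_mulLeft]
  constructor
  · rintro ⟨y, hy, rfl⟩
    rw [norm_mul, norm_zpow, zpow_add₀ hp.ne']
    gcongr
  · intro hx
    refine ⟨ϖ ^ (-m) * x, ?_, ?_⟩
    · rw [norm_mul, norm_zpow]
      calc ‖ϖ‖ ^ (-m) * ‖x‖ ≤ ‖ϖ‖ ^ (-m) * ‖ϖ‖ ^ (m + n) := by gcongr
        _ = ‖ϖ‖ ^ n := by rw [← zpow_add₀ hp.ne']; congr 1; ring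
    · rw [← mul_assoc, ← zpow_add₀ h.ne_zero]
      simp

/-- Multiplication by ϖ^m carries the pair (𝒪_F, ϖ𝒪_F) to the pair at level m. -/
theorem IsUniformizer.relIndex_fracIdeal_succ (h : IsUniformizer ϖ) (m : ℤ) :
    (fracIdeal ϖ (m + 1)).relIndex (fracIdeal ϖ m) =
      (fracIdeal ϖ 1).relIndex (fracIdeal ϖ 0) := by
  have := AddSubgroup.relIndex_map_map_of_injective (f := AddMonoidHom.mulLeft (ϖ ^ m))
    (fracIdeal ϖ 1) (fracIdeal ϖ 0) (mul_right_injective₀ (zpow_ne_zero m h.ne_zero))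
  rwa [h.map_mulLeft_fracIdeal, h.map_mulLeft_fracIdeal, add_zero] at this

theorem IsUniformizer.relIndex_fracIdeal (h : IsUniformizer ϖ) (m : ℤ) (k : ℕ) :
    (fracIdeal ϖ (m + k)).relIndex (fracIdeal ϖ m) =
      (fracIdeal ϖ 1).relIndex (fracIdeal ϖ 0) ^ k := by
  induction k with
  | zero => simp
  | succ k ih =>
    rw [← AddSubgroup.relIndex_mul_relIndex (fracIdeal ϖ (m + (k + 1 : ℕ))) (fracIdeal ϖ (m + k))
      (fracIdeal ϖ m) (h.fracIdeal_le (by push_cast; omega)) (h.fracIdeal_le (by omega)), ih,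
      pow_succ', ← h.relIndex_fracIdeal_succ (m + k)]
    push_cast
    rw [add_assoc]

/-- A ball of radius `‖ϖ‖ ^ ρ` is the union of `q ^ (n - ρ)` cosets of `ϖ ^ n 𝒪_F`. -/
theorem IsUniformizer.ncard_image_ball (h : IsUniformizer ϖ) (x₀ : F) {ρ n : ℤ} (hρ : ρ ≤ n) :
    ((QuotientAddGroup.mk : F → F ⧸ fracIdeal ϖ n) '' {t | ‖t - x₀‖ ≤ ‖ϖ‖ ^ ρ}).ncard =
      (fracIdeal ϖ 1).relIndex (fracIdeal ϖ 0) ^ (n - ρ).toNat := by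
  have e1 : (QuotientAddGroup.mk : F → F ⧸ fracIdeal ϖ n) '' {t | ‖t - x₀‖ ≤ ‖ϖ‖ ^ ρ} =
      (fun y => (x₀ : F ⧸ fracIdeal ϖ n) + y) ''
        ((fracIdeal ϖ ρ).map (QuotientAddGroup.mk' (fracIdeal ϖ n)) : Set (F ⧸ fracIdeal ϖ n)) := by
    ext y
    simp only [Set.mem_image, AddSubgroup.coe_map, SetLike.mem_coe, exists_exists_and_eq_and]
    constructor
    · rintro ⟨t, ht, rfl⟩
      exact ⟨t - x₀, ht, by rw [QuotientAddGroup.mk'_apply, ← QuotientAddGroup.mk_add]; congr 1; ring⟩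
    · rintro ⟨t, ht, rfl⟩
      exact ⟨x₀ + t, by simpa [mem_fracIdeal] using ht, rfl⟩
  rw [e1, Set.ncard_image_of_injective _ (add_right_injective _)]
  have e2 := AddSubgroup.relIndex_ker (K := fracIdeal ϖ ρ) (QuotientAddGroup.mk' (fracIdeal ϖ n))
  rw [QuotientAddGroup.ker_mk'] at e2
  rw [← Nat.card_coe_set_eq]
  refine e2.symm.trans ?_
  rw [← h.relIndex_fracIdeal ρ (n - ρ).toNat, Int.toNat_of_nonneg (by omega)]
  congr 2
  ring

theorem IsUniformizer.isOpen_fracIdeal (h : IsUniformizer ϖ) (n : ℤ) :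
    IsOpen (fracIdeal ϖ n : Set F) := by
  have : (fracIdeal ϖ n : Set F) = Metric.closedBall 0 (‖ϖ‖ ^ n) := by
    ext x
    simp [mem_fracIdeal]
  rw [this]
  exact IsUltrametricDist.isOpen_closedBall _ (zpow_pos h.norm_pos n).ne'

theorem isCompact_fracIdeal [ProperSpace F] (ϖ : F) (n : ℤ) :
    IsCompact (fracIdeal ϖ n : Set F) := by
  have : (fracIdeal ϖ n : Set F) = Metric.closedBall 0 (‖ϖ‖ ^ n) := by
    ext x
    simp [mem_fracIdeal]
  rw [this]
  exact isCompact_closedBall _ _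

theorem IsUniformizer.finite_quotient [ProperSpace F] (h : IsUniformizer ϖ) :
    Finite (fracIdeal ϖ 0 ⧸ (fracIdeal ϖ 1).addSubgroupOf (fracIdeal ϖ 0)) := by
  have : CompactSpace (fracIdeal ϖ 0) := isCompact_iff_compactSpace.mp (isCompact_fracIdeal ϖ 0)
  exact AddSubgroup.quotient_finite_of_isOpen _
    ((h.isOpen_fracIdeal 1).preimage continuous_subtype_val)

theorem IsUniformizer.relIndex_pos [ProperSpace F] (h : IsUniformizer ϖ) :
    0 < (fracIdeal ϖ 1).relIndex (fracIdeal ϖ 0) := by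
  have := h.finite_quotient
  exact Nat.card_pos

theorem IsUniformizer.finite_image_ball [ProperSpace F] (h : IsUniformizer ϖ) (x₀ : F) {ρ n : ℤ}
    (hρ : ρ ≤ n) :
    ((QuotientAddGroup.mk : F → F ⧸ fracIdeal ϖ n) '' {t | ‖t - x₀‖ ≤ ‖ϖ‖ ^ ρ}).Finite := by
  apply Set.finite_of_ncard_pos
  rw [h.ncard_image_ball x₀ hρ]
  exact pow_pos h.relIndex_pos _

/-- An element close to `1` is a square, when `2` is a unit. -/
theorem exists_sq_eq_of_norm_sub_one_lt [ProperSpace F] (h2 : ‖(2 : F)‖ = 1) {w : F}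
    (hw : ‖w - 1‖ < 1) : ∃ x : F, x ^ 2 = w := by
  obtain ⟨x, hx, hmin⟩ := (isCompact_closedBall (1 : F) ‖w - 1‖).exists_isMinOn
    ⟨1, by simp⟩ (f := fun x => ‖x ^ 2 - w‖) (by fun_prop)
  rw [mem_closedBall_iff_norm] at hx
  refine ⟨x, ?_⟩
  by_contra hne
  have hne' : x ^ 2 - w ≠ 0 := sub_ne_zero.mpr hne
  have hx1 : ‖x‖ = 1 := by
    have : x = 1 + (x - 1) := by ring
    rw [this, IsUltrametricDist.norm_add_eq_max_of_norm_ne_norm]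
    · rw [norm_one]
      exact max_eq_left (hx.trans hw.le)
    · rw [norm_one]
      exact (hx.trans_lt hw).ne'
  have hx0 : x ≠ 0 := by
    rintro rfl
    simp at hx1
  have h20 : (2 : F) ≠ 0 := by
    intro h
    rw [h] at h2
    simp at h2
  have hval : ‖x ^ 2 - w‖ ≤ ‖w - 1‖ := by
    simpa [norm_sub_rev] using hmin (show (1 : F) ∈ Metric.closedBall (1 : F) ‖w - 1‖ by simp)
  -- A Newton step from the minimizer stays in the ball and squares the norm of the error. A nonzero
  -- error is less than 1, so this contradicts minimality.
  have hstep : ‖x - (x ^ 2 - w) / (2 * x) - 1‖ ≤ ‖w - 1‖ := by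
    rw [show x - (x ^ 2 - w) / (2 * x) - 1 = (x - 1) - (x ^ 2 - w) / (2 * x) by ring]
    refine (norm_sub_le_max_of_ultrametric _ _).trans (max_le hx ?_)
    rwa [norm_div, norm_mul, h2, hx1, mul_one, div_one]
  have := hmin (mem_closedBall_iff_norm.mpr hstep)
  simp only [Set.mem_ofPred_eq] at this
  rw [show (x - (x ^ 2 - w) / (2 * x)) ^ 2 - w = ((x ^ 2 - w) / (2 * x)) ^ 2 by
    field_simp; ring, norm_pow, norm_div, norm_mul, h2, hx1, mul_one, div_one] at this
  have hlt : ‖x ^ 2 - w‖ < 1 := hval.trans_lt hw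
  have hpos : 0 < ‖x ^ 2 - w‖ := norm_pos_iff.mpr hne'
  nlinarith

end Uniformizer

/-! ### Uniformizers and residue fields of p-adic fields. -/

section PadicFields

variable {p : ℕ} [Fact p.Prime] {F : Type*} [NormedField F] [NormedAlgebra ℚ_[p] F]

/-- No norm lies strictly between |ϖ| and 1: such a y would give the factorization ϖ = y · (ϖ/y)
into nonunits. Scaling x by a power of ϖ into the interval (|ϖ|, 1] therefore gives it norm 1. -/
theorem isUniformizer_of_irreducible {ϖ : ringOfIntegers p F} (hϖ : Irreducible ϖ) :
    IsUniformizer (ϖ : F) := by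
  have hunit : ∀ y : ringOfIntegers p F, IsUnit y ↔ ‖(y : F)‖ = 1 := by
    intro y
    constructor
    · rintro ⟨u, rfl⟩
      have h1 : ‖((u : ringOfIntegers p F) : F)‖ ≤ 1 := (u : ringOfIntegers p F).2
      have h2 : ‖((u⁻¹ : (ringOfIntegers p F)ˣ) : F)‖ ≤ 1 :=
        ((u⁻¹ : (ringOfIntegers p F)ˣ) : ringOfIntegers p F).2
      have h3 : ((u : ringOfIntegers p F) : F) *
          (((u⁻¹ : (ringOfIntegers p F)ˣ) : ringOfIntegers p F) : F) = 1 := by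
        rw [← Subring.coe_mul, Units.mul_inv, Subring.coe_one]
      have h4 := congrArg norm h3
      rw [norm_mul, norm_one] at h4
      nlinarith [norm_nonneg ((u : ringOfIntegers p F) : F),
        norm_nonneg (((u⁻¹ : (ringOfIntegers p F)ˣ) : ringOfIntegers p F) : F)]
    · intro hy
      have hy0 : (y : F) ≠ 0 := by
        intro h
        rw [h] at hy
        simp at hy
      exact IsUnit.of_mul_eq_one ⟨(y : F)⁻¹, by
        change ‖(y : F)⁻¹‖ ≤ 1
        rw [norm_inv, hy, inv_one]⟩ (Subtype.ext (mul_inv_cancel₀ hy0))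
  have h0 : (ϖ : F) ≠ 0 := fun h => hϖ.ne_zero (Subtype.ext h)
  have hle : ‖(ϖ : F)‖ ≤ 1 := ϖ.2
  have hlt : ‖(ϖ : F)‖ < 1 := lt_of_le_of_ne hle fun h => hϖ.not_isUnit ((hunit ϖ).mpr h)
  have hpos : 0 < ‖(ϖ : F)‖ := norm_pos_iff.mpr h0
  refine ⟨h0, hlt, fun x hx => ?_⟩
  obtain ⟨n, hn1, hn2⟩ := exists_mem_Ioc_zpow (norm_pos_iff.mpr hx) ((one_lt_inv₀ hpos).mpr hlt)
  have key : ∀ y : F, ‖(ϖ : F)‖ < ‖y‖ → ‖y‖ ≤ 1 → ‖y‖ = 1 := by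
    intro y hy1 hy2
    have hypos : 0 < ‖y‖ := hpos.trans hy1
    have hy0 : y ≠ 0 := norm_pos_iff.mp hypos
    have hdiv : ‖(ϖ : F) / y‖ < 1 := by
      rw [norm_div, div_lt_one hypos]
      exact hy1
    have heq : ϖ = (⟨y, hy2⟩ : ringOfIntegers p F) * ⟨(ϖ : F) / y, hdiv.le⟩ :=
      Subtype.ext (by simp [mul_div_cancel₀ _ hy0])
    rcases hϖ.isUnit_or_isUnit heq with h | h
    · exact (hunit _).mp h
    · exact absurd ((hunit _).mp h) hdiv.ne
  refine ⟨-(n + 1), ?_⟩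
  have h1 := key (x * (ϖ : F) ^ (n + 1)) ?_ ?_
  · rw [norm_mul, norm_zpow] at h1
    rw [zpow_neg]
    exact eq_inv_of_mul_eq_one_left h1
  · rw [norm_mul, norm_zpow]
    rw [inv_zpow'] at hn1
    calc ‖(ϖ : F)‖ = ‖(ϖ : F)‖ ^ (-n) * ‖(ϖ : F)‖ ^ (n + 1) := by
          rw [← zpow_add₀ hpos.ne', neg_add_cancel_left, zpow_one]
      _ < ‖x‖ * ‖(ϖ : F)‖ ^ (n + 1) := by gcongr
  · rw [norm_mul, norm_zpow]
    rw [inv_zpow'] at hn2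
    calc ‖x‖ * ‖(ϖ : F)‖ ^ (n + 1) ≤ ‖(ϖ : F)‖ ^ (-(n + 1)) * ‖(ϖ : F)‖ ^ (n + 1) := by gcongr
      _ = 1 := by rw [← zpow_add₀ hpos.ne', neg_add_cancel, zpow_zero]

theorem residueCard_eq_relIndex [IsUltrametricDist F] {ϖ : ringOfIntegers p F}
    (h : IsUniformizer (ϖ : F)) :
    residueCard p F ϖ = (fracIdeal (ϖ : F) 1).relIndex (fracIdeal (ϖ : F) 0) := by
  have e : (Ideal.span {ϖ}).toAddSubgroup =
      (fracIdeal (ϖ : F) 1).comap (ringOfIntegers p F).subtype.toAddMonoidHom := by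
    ext y
    simp only [Submodule.mem_toAddSubgroup, Ideal.mem_span_singleton, AddSubgroup.mem_comap,
      mem_fracIdeal, zpow_one]
    change ϖ ∣ y ↔ ‖(y : F)‖ ≤ _
    constructor
    · rintro ⟨z, rfl⟩
      rw [Subring.coe_mul, norm_mul]
      exact mul_le_of_le_one_right (norm_nonneg _) z.2
    · intro hy
      refine ⟨⟨(y : F) / ϖ, ?_⟩, Subtype.ext ?_⟩
      · change ‖(y : F) / ϖ‖ ≤ 1
        rw [norm_div]
        exact div_le_one_of_le₀ hy (norm_nonneg _)
      · simp [mul_div_cancel₀ _ h.ne_zero]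
  have e2 : (ringOfIntegers p F).subtype.toAddMonoidHom.range = fracIdeal (ϖ : F) 0 := by
    ext y
    rw [AddMonoidHom.mem_range, mem_fracIdeal, zpow_zero]
    constructor
    · rintro ⟨z, rfl⟩
      exact z.2
    · intro hy
      exact ⟨⟨y, hy⟩, rfl⟩
  rw [residueCard, ← e2, ← AddSubgroup.index_comap, ← e]
  rfl

theorem norm_two_eq_one (hp : 2 < p) : ‖(2 : F)‖ = 1 := by
  have h : ((2 : ℕ) : ℚ_[p]) = 2 := by norm_cast
  have := norm_algebraMap' F (2 : ℚ_[p])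
  rw [map_ofNat] at this
  rw [this, ← h]
  refine (Padic.norm_natCast_eq_one_iff).mpr ?_
  exact (Nat.coprime_primes Fact.out Nat.prime_two).mpr hp.ne'

end PadicFields

/-! ### The modular character and measures of right cosets. -/

section Haar

variable {G : Type*} [TopologicalSpace G] [Group G] [IsTopologicalGroup G] [LocallyCompactSpace G]

open Measure

theorem modularCharacter_eq_one_of_sq {g : G} (h : modularCharacter (g ^ 2) = 1) :
    modularCharacter g = 1 := by
  rw [map_pow] at h
  exact (pow_eq_one_iff_of_nonneg zero_le two_ne_zero).mp h

theorem modularCharacter_conj (g h : G) :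
    modularCharacter (g * h * g⁻¹) = modularCharacter h := by
  have h1 : modularCharacter g * modularCharacter g⁻¹ = 1 := by
    rw [← map_mul, mul_inv_cancel, map_one]
  rw [map_mul, map_mul, mul_right_comm, h1, one_mul]

theorem modularCharacter_of_central {z : G} (hz : ∀ g, g * z = z * g) :
    modularCharacter z = 1 := by
  borelize G
  change modularCharacterFun z = 1
  rw [modularCharacterFun_eq_haarScalarFactor haar]
  simp only [hz, map_mul_left_eq_self, haarScalarFactor_self]

/-- The set is the right coset K g, while Haar measure is only left invariant. The pushforward of μ
under right translation is again a left Haar measure, with scalar factor the modular character; on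
sets with compact closure the comparison needs no regularity of μ. -/
theorem measure_rightCoset_eq [MeasurableSpace G] [BorelSpace G] (μ : Measure G) [IsHaarMeasure μ]
    {K : Set G} (hK : IsCompact K) (hKo : IsOpen K) {g : G} (hg : modularCharacter g = 1) :
    μ {x | x * g⁻¹ ∈ K} = μ K := by
  have hg' : modularCharacter g⁻¹ = 1 := by
    have : modularCharacter g * modularCharacter g⁻¹ = 1 := by
      rw [← map_mul, mul_inv_cancel, map_one]
    rwa [hg, one_mul] at this
  change modularCharacterFun g⁻¹ = 1 at hg'
  rw [modularCharacterFun_eq_haarScalarFactor μ] at hg'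
  have hKc : IsCompact (closure K) :=
    hK.closure
  have h := measure_isMulInvariant_eq_smul_of_isCompact_closure (map (· * g⁻¹) μ) μ hKc
  rw [hg', one_smul, map_apply (measurable_mul_const g⁻¹) hKo.measurableSet] at h
  exact h

end Haar

/-! ### Integration over finitely many right cosets. -/

section RightCosets

variable {G : Type*} [TopologicalSpace G] [Group G] [IsTopologicalGroup G]

/-- The integral of a function that is constant on finitely many disjoint right cosets of measure
one and vanishes elsewhere. -/
theorem integral_eq_sum_rightCosets [MeasurableSpace G] [BorelSpace G] (μ : Measure G)
    {K : Set G} (hKo : IsOpen K) {ι : Type*} (s : Finset ι) (g : ι → G)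
    (hμ : ∀ i ∈ s, μ {x | x * (g i)⁻¹ ∈ K} = 1) (f : G → ℂ)
    (hdisj : ∀ i ∈ s, ∀ j ∈ s, ∀ x, x * (g i)⁻¹ ∈ K → x * (g j)⁻¹ ∈ K → i = j)
    (hf : ∀ i ∈ s, ∀ x, x * (g i)⁻¹ ∈ K → f x = f (g i))
    (h0 : ∀ x, (∀ i ∈ s, x * (g i)⁻¹ ∉ K) → f x = 0) :
    Integrable f μ ∧ ∫ x, f x ∂μ = ∑ i ∈ s, f (g i) := by
  have hmeas : ∀ i, MeasurableSet {x | x * (g i)⁻¹ ∈ K} := fun i =>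
    (hKo.preimage (continuous_mul_const (g i)⁻¹)).measurableSet
  have hfe : f = fun x => ∑ i ∈ s, {x | x * (g i)⁻¹ ∈ K}.indicator (fun _ => f (g i)) x := by
    funext x
    by_cases hx : ∃ i ∈ s, x * (g i)⁻¹ ∈ K
    · obtain ⟨i, hi, hxi⟩ := hx
      rw [Finset.sum_eq_single_of_mem i hi, Set.indicator_of_mem (by exact hxi), hf i hi x hxi]
      intro j hj hji
      have : x ∉ {x | x * (g j)⁻¹ ∈ K} := fun hxj => hji (hdisj j hj i hi x hxj hxi)
      rw [Set.indicator_of_notMem this]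
    · push Not at hx
      rw [h0 x hx]
      symm
      apply Finset.sum_eq_zero
      intro i hi
      have : x ∉ {x | x * (g i)⁻¹ ∈ K} := hx i hi
      rw [Set.indicator_of_notMem this]
  have hint : ∀ i ∈ s, Integrable ({x | x * (g i)⁻¹ ∈ K}.indicator (fun _ => f (g i))) μ := by
    intro i hi
    rw [integrable_indicator_iff (hmeas i)]
    exact integrableOn_const (by rw [hμ i hi]; exact ENNReal.one_ne_top)
  constructor
  · rw [hfe]
    exact integrable_finsetSum s hint
  · conv_lhs => rw [hfe]
    rw [integral_finsetSum s hint]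
    refine Finset.sum_congr rfl fun i hi => ?_
    rw [integral_indicator_const _ (hmeas i), measureReal_def, hμ i hi]
    simp

end RightCosets

/-! ### Iwasawa decomposition and integration on GL_2. -/

section GL2

variable {F : Type*} [NormedField F]

/-- The upper triangular matrix with diagonal `α, β` and upper right entry `t`. -/
def upperTriangularGL (α β : Fˣ) (t : F) : GL (Fin 2) F where
  val := !![(α : F), t; 0, (β : F)]
  inv := !![((α⁻¹ : Fˣ) : F), -(((α⁻¹ : Fˣ) : F) * t * ((β⁻¹ : Fˣ) : F)); 0, ((β⁻¹ : Fˣ) : F)]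
  val_inv := by
    rw [Matrix.mul_fin_two, Matrix.one_fin_two]
    simp [mul_assoc]
  inv_val := by
    rw [Matrix.mul_fin_two, Matrix.one_fin_two]
    simp [mul_assoc]

theorem coe_upperTriangularGL (α β : Fˣ) (t : F) :
    (upperTriangularGL α β t : Matrix (Fin 2) (Fin 2) F) = !![(α : F), t; 0, (β : F)] := rfl

theorem coe_inv_upperTriangularGL (α β : Fˣ) (t : F) :
    (((upperTriangularGL α β t)⁻¹ : GL (Fin 2) F) : Matrix (Fin 2) (Fin 2) F) =
      !![(α : F)⁻¹, -((α : F)⁻¹ * t * (β : F)⁻¹); 0, (β : F)⁻¹] := by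
  rw [← Units.val_inv_eq_inv_val, ← Units.val_inv_eq_inv_val]
  rfl

theorem upperTriangularGL_mul (α β α' β' : Fˣ) (t t' : F) :
    upperTriangularGL α β t * upperTriangularGL α' β' t' =
      upperTriangularGL (α * α') (β * β') (α * t' + t * β') := by
  apply Units.ext
  rw [Units.val_mul, coe_upperTriangularGL, coe_upperTriangularGL, coe_upperTriangularGL,
    Matrix.mul_fin_two]
  simp

open Measure

/-- Only triviality on upper triangular matrices is needed. A unipotent is conjugate to its inverse
by diag(-1, 1), and diag(α, β) is conjugate to diag(β, α), their product being central. In both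
cases the square of the positive number in question is 1. -/
theorem modularCharacter_upperTriangularGL [LocallyCompactSpace (GL (Fin 2) F)] (α β : Fˣ) (t : F) :
    modularCharacter (upperTriangularGL α β t) = 1 := by
  have hU : ∀ x : F, modularCharacter (upperTriangularGL 1 1 x) = 1 := by
    intro x
    have h1 := modularCharacter_conj (upperTriangularGL (-1) 1 0) (upperTriangularGL 1 1 x)
    have h2 : upperTriangularGL (-1) 1 0 * upperTriangularGL 1 1 x *
        (upperTriangularGL (-1) 1 0 : GL (Fin 2) F)⁻¹ = (upperTriangularGL 1 1 x)⁻¹ := by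
      rw [mul_inv_eq_iff_eq_mul, eq_inv_mul_iff_mul_eq, upperTriangularGL_mul,
        upperTriangularGL_mul]
      simp
    apply modularCharacter_eq_one_of_sq
    rw [sq, map_mul]
    nth_rw 1 [← h1]
    rw [h2, ← map_mul, inv_mul_cancel, map_one]
  have hD : modularCharacter (upperTriangularGL α β 0) = 1 := by
    let w : GL (Fin 2) F := ⟨!![0, 1; 1, 0], !![0, 1; 1, 0],
      by rw [Matrix.mul_fin_two, Matrix.one_fin_two]; simp,
      by rw [Matrix.mul_fin_two, Matrix.one_fin_two]; simp⟩
    have h1 : w * upperTriangularGL α β 0 * w⁻¹ = upperTriangularGL β α 0 := by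
      rw [mul_inv_eq_iff_eq_mul]
      apply Units.ext
      rw [Units.val_mul, Units.val_mul, coe_upperTriangularGL, coe_upperTriangularGL,
        Matrix.mul_fin_two, Matrix.mul_fin_two]
      simp
    have h2 : ∀ g : GL (Fin 2) F, g * upperTriangularGL (α * β) (α * β) 0 =
        upperTriangularGL (α * β) (α * β) 0 * g := by
      intro g
      apply Units.ext
      rw [Units.val_mul, Units.val_mul, coe_upperTriangularGL,
        Matrix.eta_fin_two (g : Matrix (Fin 2) (Fin 2) F), Matrix.mul_fin_two, Matrix.mul_fin_two]
      simp [mul_comm]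
    apply modularCharacter_eq_one_of_sq
    rw [sq, map_mul]
    nth_rw 2 [← modularCharacter_conj w]
    rw [h1, ← map_mul, upperTriangularGL_mul, mul_comm β α]
    simpa using modularCharacter_of_central h2
  have : upperTriangularGL α β t =
      upperTriangularGL 1 1 (t * ((β⁻¹ : Fˣ) : F)) * upperTriangularGL α β 0 := by
    rw [upperTriangularGL_mul]
    simp
  rw [this, map_mul, hU, hD, one_mul]

variable {ϖ : F}

/-- The representative `[[ϖ ^ m, t], [0, ϖ ^ n]]` of a coset of `GL_2(𝒪_F)`. -/
noncomputable def IsUniformizer.rep (h : IsUniformizer ϖ) (m n : ℤ) (t : F) : GL (Fin 2) F :=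
  upperTriangularGL (Units.mk0 ϖ h.ne_zero ^ m) (Units.mk0 ϖ h.ne_zero ^ n) t

theorem IsUniformizer.coe_rep (h : IsUniformizer ϖ) (m n : ℤ) (t : F) :
    (h.rep m n t : Matrix (Fin 2) (Fin 2) F) = !![ϖ ^ m, t; 0, ϖ ^ n] := by
  simp [IsUniformizer.rep, coe_upperTriangularGL]

theorem IsUniformizer.coe_inv_rep (h : IsUniformizer ϖ) (m n : ℤ) (t : F) :
    (((h.rep m n t)⁻¹ : GL (Fin 2) F) : Matrix (Fin 2) (Fin 2) F) =
      !![(ϖ ^ m)⁻¹, -((ϖ ^ m)⁻¹ * t * (ϖ ^ n)⁻¹); 0, (ϖ ^ n)⁻¹] := by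
  rw [IsUniformizer.rep, coe_inv_upperTriangularGL]
  simp

theorem IsUniformizer.rep_mul_inv_rep (h : IsUniformizer ϖ) (m n m' n' : ℤ) (t t' : F) :
    ((h.rep m n t * (h.rep m' n' t')⁻¹ : GL (Fin 2) F) : Matrix (Fin 2) (Fin 2) F) =
      !![ϖ ^ (m - m'), (t - ϖ ^ (m - m') * t') * (ϖ ^ n')⁻¹; 0, ϖ ^ (n - n')] := by
  have := h.ne_zero
  rw [Units.val_mul, h.coe_rep, h.coe_inv_rep, Matrix.mul_fin_two, zpow_sub₀ this, zpow_sub₀ this]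
  congr 1
  simp [div_eq_mul_inv]
  ring

theorem integralGL_inv_mem {h : GL (Fin 2) F} (hh : h ∈ integralGL F 2) :
    h⁻¹ ∈ integralGL F 2 := by
  obtain ⟨h1, h2⟩ := hh
  have hi : ((h⁻¹ : GL (Fin 2) F) : Matrix (Fin 2) (Fin 2) F) =
      ((h : Matrix (Fin 2) (Fin 2) F).det)⁻¹ • !![h 1 1, - h 0 1; - h 1 0, h 0 0] := by
    rw [Matrix.coe_units_inv, Matrix.inv_def, Matrix.adjugate_fin_two, Ring.inverse_eq_inv']
  refine ⟨fun i j => ?_, ?_⟩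
  · rw [hi, Matrix.smul_apply, smul_eq_mul, norm_mul, norm_inv, h2, inv_one, one_mul]
    fin_cases i <;> fin_cases j <;> simp [h1]
  · rw [Matrix.coe_units_inv, Matrix.det_nonsing_inv, Ring.inverse_eq_inv', norm_inv, h2, inv_one]

/-- Iwasawa decomposition. The entry of larger norm in the first column serves as pivot: its
valuation is m, the determinant forces n = k - m, and t is chosen to annihilate the second-column
entry in the row of the pivot. -/
theorem IsUniformizer.exists_mul_inv_rep_mem (h : IsUniformizer ϖ) (g : GL (Fin 2) F) :
    ∃ m n t, g * (h.rep m n t)⁻¹ ∈ integralGL F 2 := by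
  obtain ⟨x, y, z, w, hg⟩ : ∃ x y z w, (g : Matrix (Fin 2) (Fin 2) F) = !![x, y; z, w] :=
    ⟨_, _, _, _, Matrix.eta_fin_two _⟩
  have hd0 : x * w - y * z ≠ 0 := by
    have := g.det.ne_zero
    rwa [Matrix.GeneralLinearGroup.val_det_apply, hg, Matrix.det_fin_two_of] at this
  obtain ⟨k, hk⟩ := h.exists_zpow _ hd0
  have key : ∀ m t, ‖x‖ ≤ ‖ϖ‖ ^ m → ‖z‖ ≤ ‖ϖ‖ ^ m →
      ‖y - x * (ϖ ^ m)⁻¹ * t‖ ≤ ‖ϖ‖ ^ (k - m) → ‖w - z * (ϖ ^ m)⁻¹ * t‖ ≤ ‖ϖ‖ ^ (k - m) →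
      ∃ m n t, g * (h.rep m n t)⁻¹ ∈ integralGL F 2 := by
    intro m t h1 h2 h3 h4
    have hp := h.norm_pos
    have e : ((g * (h.rep m (k - m) t)⁻¹ : GL (Fin 2) F) : Matrix (Fin 2) (Fin 2) F) =
        !![x * (ϖ ^ m)⁻¹, (y - x * (ϖ ^ m)⁻¹ * t) * (ϖ ^ (k - m))⁻¹;
          z * (ϖ ^ m)⁻¹, (w - z * (ϖ ^ m)⁻¹ * t) * (ϖ ^ (k - m))⁻¹] := by
      rw [Units.val_mul, h.coe_inv_rep, hg, Matrix.mul_fin_two]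
      congr 1
      simp
      constructor <;> ring
    have hn : ∀ (x : F) (n : ℤ), ‖x * (ϖ ^ n)⁻¹‖ ≤ 1 ↔ ‖x‖ ≤ ‖ϖ‖ ^ n := by
      intro x n
      rw [norm_mul, norm_inv, norm_zpow, ← div_eq_mul_inv, div_le_one (zpow_pos h.norm_pos n)]
    refine ⟨m, k - m, t, fun i j => ?_, ?_⟩
    · rw [e]
      rw [← hn] at h1 h2 h3 h4
      fin_cases i <;> fin_cases j
      exacts [h1, h3, h2, h4]
    · rw [e, Matrix.det_fin_two_of]
      have : x * (ϖ ^ m)⁻¹ * ((w - z * (ϖ ^ m)⁻¹ * t) * (ϖ ^ (k - m))⁻¹) -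
          (y - x * (ϖ ^ m)⁻¹ * t) * (ϖ ^ (k - m))⁻¹ * (z * (ϖ ^ m)⁻¹) =
          (x * w - y * z) * ((ϖ ^ (k - m))⁻¹ * (ϖ ^ m)⁻¹) := by ring
      rw [this, ← mul_inv, ← zpow_add₀ h.ne_zero, sub_add_cancel, norm_mul, hk, norm_inv, norm_zpow,
        mul_inv_cancel₀ (zpow_pos hp k).ne']
  have hp := h.norm_pos
  rcases le_total ‖z‖ ‖x‖ with hzx | hxz
  · have hx0 : x ≠ 0 := by
      rintro rfl
      have : z = 0 := by simpa using hzx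
      simp [this] at hd0
    obtain ⟨m, hm⟩ := h.exists_zpow x hx0
    have := zpow_ne_zero m h.ne_zero
    refine key m (y * x⁻¹ * ϖ ^ m) hm.le (hzx.trans hm.le) ?_ ?_
    · have e : y - x * (ϖ ^ m)⁻¹ * (y * x⁻¹ * ϖ ^ m) = 0 := by field_simp; ring
      rw [e, norm_zero]
      positivity
    · have e : w - z * (ϖ ^ m)⁻¹ * (y * x⁻¹ * ϖ ^ m) = (x * w - y * z) * x⁻¹ := by field_simp
      rw [e, norm_mul, hk, norm_inv, hm, zpow_sub₀ hp.ne', div_eq_mul_inv]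
  · have hz0 : z ≠ 0 := by
      rintro rfl
      have : x = 0 := by simpa using hxz
      simp [this] at hd0
    obtain ⟨m, hm⟩ := h.exists_zpow z hz0
    have := zpow_ne_zero m h.ne_zero
    refine key m (w * z⁻¹ * ϖ ^ m) (hxz.trans hm.le) hm.le ?_ ?_
    · have e : y - x * (ϖ ^ m)⁻¹ * (w * z⁻¹ * ϖ ^ m) = - ((x * w - y * z) * z⁻¹) := by
        field_simp; ring
      rw [e, norm_neg, norm_mul, hk, norm_inv, hm, zpow_sub₀ hp.ne', div_eq_mul_inv]
    · have e : w - z * (ϖ ^ m)⁻¹ * (w * z⁻¹ * ϖ ^ m) = 0 := by field_simp; ring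
      rw [e, norm_zero]
      positivity

variable [IsUltrametricDist F]

theorem integralGL_mul_mem {g h : GL (Fin 2) F} (hg : g ∈ integralGL F 2)
    (hh : h ∈ integralGL F 2) : g * h ∈ integralGL F 2 := by
  refine ⟨fun i j => ?_, ?_⟩
  · rw [Units.val_mul, Matrix.mul_apply, Fin.sum_univ_two]
    refine (IsUltrametricDist.norm_add_le_max _ _).trans (max_le ?_ ?_) <;>
    · rw [norm_mul]
      exact mul_le_one₀ (hg.1 _ _) (norm_nonneg _) (hh.1 _ _)
  · rw [Units.val_mul, Matrix.det_mul, norm_mul, hg.2, hh.2, one_mul]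

/-- The subgroup `GL_2(𝒪_F)` of `GL_2(F)`. -/
def integralSubgroup (F : Type*) [NormedField F] [IsUltrametricDist F] :
    Subgroup (GL (Fin 2) F) where
  carrier := integralGL F 2
  mul_mem' := integralGL_mul_mem
  one_mem' := by
    refine ⟨fun i j => ?_, by simp⟩
    rw [Units.val_one, Matrix.one_apply]
    split_ifs <;> simp
  inv_mem' := integralGL_inv_mem

theorem isOpen_integralGL : IsOpen (integralGL F 2) := by
  have e : integralGL F 2 = (⋂ i : Fin 2, ⋂ j : Fin 2, {h : GL (Fin 2) F |
      (h : Matrix (Fin 2) (Fin 2) F) i j ∈ Metric.closedBall (0 : F) 1}) ∩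
      {h : GL (Fin 2) F | (h : Matrix (Fin 2) (Fin 2) F).det ∈ Metric.sphere (0 : F) 1} := by
    ext h
    simp [integralGL]
  rw [e]
  refine IsOpen.inter (isOpen_iInter_of_finite fun i => isOpen_iInter_of_finite fun j => ?_) ?_
  · exact (IsUltrametricDist.isOpen_closedBall (0 : F) one_ne_zero).preimage
      (Units.continuous_val.matrix_elem i j)
  · exact (IsUltrametricDist.isOpen_sphere (0 : F) one_ne_zero).preimage
      Units.continuous_val.matrix_det

/-- Under the closed embedding g ↦ (g, g⁻¹) the group is the preimage of a product of unit balls: if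
both matrices are integral, their determinants have norm at most 1 and product 1. -/
theorem isCompact_integralGL [ProperSpace F] : IsCompact (integralGL F 2) := by
  let B : Set (Matrix (Fin 2) (Fin 2) F) :=
    Set.univ.pi fun _ => Set.univ.pi fun _ => Metric.closedBall (0 : F) 1
  have hB : IsCompact B := isCompact_univ_pi fun _ => isCompact_univ_pi fun _ =>
    isCompact_closedBall _ _
  have hB' : IsCompact (MulOpposite.unop ⁻¹' B : Set (Matrix (Fin 2) (Fin 2) F)ᵐᵒᵖ) :=
    MulOpposite.opHomeomorph.symm.isClosedEmbedding.isCompact_preimage hB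
  have e : integralGL F 2 = Units.embedProduct (Matrix (Fin 2) (Fin 2) F) ⁻¹'
      (B ×ˢ (MulOpposite.unop ⁻¹' B)) := by
    ext h
    have hBm : ∀ A : Matrix (Fin 2) (Fin 2) F, A ∈ B ↔ ∀ i j, ‖A i j‖ ≤ 1 := by
      intro A
      exact ⟨fun h i j => mem_closedBall_zero_iff.mp (h i trivial j trivial),
        fun h i _ j _ => mem_closedBall_zero_iff.mpr (h i j)⟩
    have hdet : ∀ A : Matrix (Fin 2) (Fin 2) F, (∀ i j, ‖A i j‖ ≤ 1) → ‖A.det‖ ≤ 1 := by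
      intro A hA
      rw [Matrix.det_fin_two]
      refine (norm_sub_le_max_of_ultrametric _ _).trans (max_le ?_ ?_) <;>
      · rw [norm_mul]
        exact mul_le_one₀ (hA _ _) (norm_nonneg _) (hA _ _)
    simp only [Units.embedProduct_apply, Set.mem_preimage, Set.mem_prod, hBm,
      MulOpposite.unop_op]
    constructor
    · intro hh
      exact ⟨hh.1, (integralGL_inv_mem hh).1⟩
    · rintro ⟨h1, h2⟩
      refine ⟨h1, le_antisymm (hdet _ h1) ?_⟩
      have h3 : (h : Matrix (Fin 2) (Fin 2) F).det *
          ((h⁻¹ : GL (Fin 2) F) : Matrix (Fin 2) (Fin 2) F).det = 1 := by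
        rw [← Matrix.det_mul, Units.mul_inv, Matrix.det_one]
      have h4 := congrArg norm h3
      rw [norm_mul, norm_one] at h4
      nlinarith [hdet _ h1, hdet _ h2, norm_nonneg (h : Matrix (Fin 2) (Fin 2) F).det]
  rw [e]
  exact Units.isClosedEmbedding_embedProduct.isCompact_preimage (hB.prod hB')

theorem IsUniformizer.rep_mul_inv_mem_iff (h : IsUniformizer ϖ) (m n m' n' : ℤ) (t t' : F) :
    h.rep m n t * (h.rep m' n' t')⁻¹ ∈ integralGL F 2 ↔
      m = m' ∧ n = n' ∧ t - t' ∈ fracIdeal ϖ n := by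
  have hn : ∀ (x : F) (n : ℤ), ‖x * (ϖ ^ n)⁻¹‖ ≤ 1 ↔ x ∈ fracIdeal ϖ n := by
    intro x n
    rw [mem_fracIdeal, norm_mul, norm_inv, norm_zpow, ← div_eq_mul_inv,
      div_le_one (zpow_pos h.norm_pos n)]
  constructor
  · rintro ⟨h1, h2⟩
    rw [h.rep_mul_inv_rep] at h1 h2
    have a1 : ‖ϖ ^ (m - m')‖ ≤ 1 := h1 0 0
    have a2 : ‖ϖ ^ (n - n')‖ ≤ 1 := h1 1 1
    have a3 : ‖(t - ϖ ^ (m - m') * t') * (ϖ ^ n')⁻¹‖ ≤ 1 := h1 0 1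
    rw [Matrix.det_fin_two_of, mul_zero, sub_zero, norm_mul, norm_zpow, norm_zpow,
      ← zpow_add₀ h.norm_pos.ne', ← zpow_zero ‖ϖ‖, h.zpow_inj] at h2
    rw [norm_zpow, h.zpow_le_one] at a1 a2
    obtain rfl : m = m' := by omega
    obtain rfl : n = n' := by omega
    rw [hn] at a3
    simpa using a3
  · rintro ⟨rfl, rfl, h3⟩
    refine ⟨fun i j => ?_, ?_⟩
    · rw [h.rep_mul_inv_rep]
      rw [← hn] at h3
      fin_cases i <;> fin_cases j <;> simp
      simpa using h3
    · rw [h.rep_mul_inv_rep]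
      simp

/-- The integral of a left `GL_2(𝒪_F)`-invariant function on `GL_2(F)`. -/
theorem IsUniformizer.integral_eq_sum_ncard [ProperSpace F] (h : IsUniformizer ϖ)
    [MeasurableSpace (GL (Fin 2) F)] [BorelSpace (GL (Fin 2) F)]
    (μ : Measure (GL (Fin 2) F)) [μ.IsHaarMeasure] (hμ : μ (integralGL F 2) = 1)
    (f : GL (Fin 2) F → ℂ) (hf : ∀ k ∈ integralGL F 2, ∀ x, f (k * x) = f x)
    (s : Finset (ℤ × ℤ)) (C : ℤ × ℤ → Set F) (W : ℤ × ℤ → ℂ)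
    (hC : ∀ i t, t ∈ C i → f (h.rep i.1 i.2 t) = W i)
    (hC0 : ∀ i t, t ∉ C i → f (h.rep i.1 i.2 t) = 0)
    (hs : ∀ i, i ∉ s → C i = ∅)
    (hfin : ∀ i, ((QuotientAddGroup.mk : F → F ⧸ fracIdeal ϖ i.2) '' C i).Finite) :
    Integrable f μ ∧ ∫ x, f x ∂μ =
      ∑ i ∈ s, W i * (((QuotientAddGroup.mk : F → F ⧸ fracIdeal ϖ i.2) '' C i).ncard : ℂ) := by
  have : LocallyCompactSpace (Matrix (Fin 2) (Fin 2) F) :=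
    inferInstanceAs (LocallyCompactSpace (Fin 2 → Fin 2 → F))
  have : LocallyCompactSpace (GL (Fin 2) F) :=
    Units.isClosedEmbedding_embedProduct.locallyCompactSpace
  -- `S` indexes the cosets on which the integrand may be nonzero. The representative `ρ` is
  -- meaningful only on `S`; its value elsewhere is never used.
  let S : Finset (Σ i : ℤ × ℤ, F ⧸ fracIdeal ϖ i.2) := s.sigma fun i => (hfin i).toFinset
  let ρ : (Σ i : ℤ × ℤ, F ⧸ fracIdeal ϖ i.2) → F := fun i =>
    Classical.epsilon fun t => t ∈ C i.1 ∧ (t : F ⧸ fracIdeal ϖ i.1.2) = i.2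
  have hρ : ∀ i ∈ S, ρ i ∈ C i.1 ∧ (ρ i : F ⧸ fracIdeal ϖ i.1.2) = i.2 := by
    intro i hi
    have h1 := (Finset.mem_sigma.mp hi).2
    rw [Set.Finite.mem_toFinset] at h1
    obtain ⟨t, ht⟩ := h1
    exact Classical.epsilon_spec (p := fun t => t ∈ C i.1 ∧ (t : F ⧸ fracIdeal ϖ i.1.2) = i.2)
      ⟨t, ht⟩
  let g : (Σ i : ℤ × ℤ, F ⧸ fracIdeal ϖ i.2) → GL (Fin 2) F := fun i =>
    h.rep i.1.1 i.1.2 (ρ i)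
  have main := integral_eq_sum_rightCosets μ (K := integralGL F 2) isOpen_integralGL S g ?_ f
    ?_ ?_ ?_
  · refine ⟨main.1, main.2.trans ?_⟩
    rw [Finset.sum_sigma]
    refine Finset.sum_congr rfl fun i hi => ?_
    rw [Finset.sum_congr rfl (g := fun _ => W i), Finset.sum_const, nsmul_eq_mul, mul_comm,
      Set.ncard_eq_toFinset_card _ (hfin i)]
    intro y hy
    exact hC i _ (hρ ⟨i, y⟩ (Finset.mem_sigma.mpr ⟨hi, hy⟩)).1
  · intro i _
    exact (measure_rightCoset_eq μ isCompact_integralGL isOpen_integralGL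
      (modularCharacter_upperTriangularGL _ _ _)).trans hμ
  · intro i hi j hj x hxi hxj
    have h1 : g i * (g j)⁻¹ ∈ integralGL F 2 := by
      have := (integralSubgroup F).mul_mem ((integralSubgroup F).inv_mem hxi) hxj
      rw [mul_inv_rev, inv_inv, mul_assoc, inv_mul_cancel_left] at this
      exact this
    rw [h.rep_mul_inv_mem_iff] at h1
    obtain ⟨h2, h3, h4⟩ := h1
    have hi' := (hρ i hi).2
    have hj' := (hρ j hj).2
    obtain ⟨⟨m, n⟩, y⟩ := i
    obtain ⟨⟨m', n'⟩, y'⟩ := j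
    dsimp only at h2 h3 h4 hi' hj'
    subst h2 h3
    congr 1
    rw [← hi', ← hj', QuotientAddGroup.eq_iff_sub_mem]
    exact h4
  · intro i _ x hx
    rw [← inv_mul_cancel_right x (g i), hf _ hx]
  · intro x hx
    obtain ⟨m, n, t, hmem⟩ := h.exists_mul_inv_rep_mem x
    have hxf : f x = f (h.rep m n t) := by
      rw [← inv_mul_cancel_right x (h.rep m n t), hf _ hmem]
    rw [hxf]
    refine hC0 (m, n) t fun ht => ?_
    have hmn : (m, n) ∈ s := by
      by_contra hn
      rw [hs _ hn] at ht
      exact ht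
    have hiS : (⟨(m, n), (t : F ⧸ fracIdeal ϖ n)⟩ : Σ i : ℤ × ℤ, F ⧸ fracIdeal ϖ i.2) ∈ S :=
      Finset.mem_sigma.mpr ⟨hmn, (Set.Finite.mem_toFinset _).mpr ⟨t, ht, rfl⟩⟩
    refine hx _ hiS ?_
    have h1 : h.rep m n t * (g ⟨(m, n), (t : F ⧸ fracIdeal ϖ n)⟩)⁻¹ ∈ integralGL F 2 := by
      rw [h.rep_mul_inv_mem_iff]
      refine ⟨rfl, rfl, ?_⟩
      have := (hρ _ hiS).2
      dsimp only at this
      rw [← QuotientAddGroup.eq_iff_sub_mem]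
      exact this.symm
    have := (integralSubgroup F).mul_mem hmem h1
    rw [mul_assoc, inv_mul_cancel_left] at this
    exact this

end GL2

/-! ### The conjugation of a quadratic extension. -/

section Quadratic

variable {F E : Type*} [NormedField F] [NormedField E] [NormedAlgebra F E]

/-- A linear automorphism of a finite-dimensional space is bounded. If |σx| exceeded |x|, the ratio
for x^n would be unbounded in n. -/
theorem norm_algEquiv_apply [ProperSpace F] [FiniteDimensional F E] {ϖ : F} (h : IsUniformizer ϖ)
    (σ : E ≃ₐ[F] E) (x : E) : ‖σ x‖ = ‖x‖ := by
  let _ : NontriviallyNormedField F :=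
    { ‹NormedField F› with
      non_trivial := ⟨ϖ⁻¹, by
        rw [norm_inv]
        exact (one_lt_inv₀ h.norm_pos).mpr h.norm_lt_one⟩ }
  have key : ∀ (σ : E ≃ₐ[F] E) (x : E), ‖σ x‖ ≤ ‖x‖ := by
    intro σ x
    let f : E →L[F] E := ⟨σ.toLinearMap, LinearMap.continuous_of_finiteDimensional _⟩
    have hf : ∀ y, ‖σ y‖ ≤ ‖f‖ * ‖y‖ := fun y => f.le_opNorm y
    by_contra hlt
    push Not at hlt
    by_cases hx : x = 0
    · simp [hx] at hlt
    have hxp : 0 < ‖x‖ := norm_pos_iff.mpr hx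
    obtain ⟨n, hn⟩ := pow_unbounded_of_one_lt ‖f‖ ((one_lt_div hxp).mpr hlt)
    have h1 := hf (x ^ n)
    rw [map_pow, norm_pow, norm_pow, ← div_le_iff₀ (pow_pos hxp n), ← div_pow] at h1
    exact absurd h1 (not_le.mpr hn)
  refine le_antisymm (key σ x) ?_
  simpa using key σ.symm (σ x)

theorem algEquiv_eq_one_or_eq (hE : Module.finrank F E = 2) (σ : E ≃ₐ[F] E) (hσ : σ ≠ 1)
    (τ : E ≃ₐ[F] E) : τ = 1 ∨ τ = σ := by
  have : FiniteDimensional F E := Module.finite_of_finrank_eq_succ hE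
  classical
  by_contra hτ
  push Not at hτ
  have h1 := AlgEquiv.card_le (F := F) (K := E)
  rw [hE] at h1
  have h2 : ({1, σ, τ} : Finset (E ≃ₐ[F] E)).card = 3 :=
    Finset.card_eq_three.mpr ⟨1, σ, τ, hσ.symm, hτ.1.symm, hτ.2.symm, rfl⟩
  have h3 := Finset.card_le_univ ({1, σ, τ} : Finset (E ≃ₐ[F] E))
  omega

theorem algEquiv_involutive (hE : Module.finrank F E = 2) (σ : E ≃ₐ[F] E) (hσ : σ ≠ 1)
    (x : E) : σ (σ x) = x := by
  have h : σ * σ = 1 := by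
    rcases algEquiv_eq_one_or_eq hE σ hσ (σ * σ) with h | h
    · exact h
    · exact absurd (mul_eq_left.mp h) hσ
  exact congrArg (fun τ : E ≃ₐ[F] E => τ x) h

theorem exists_algebraMap_eq_of_fixed (hE : Module.finrank F E = 2) (σ : E ≃ₐ[F] E) (hσ : σ ≠ 1)
    {x : E} (hx : σ x = x) : ∃ y : F, algebraMap F E y = x := by
  have : FiniteDimensional F E := Module.finite_of_finrank_eq_succ hE
  have hcard : Nat.card (E ≃ₐ[F] E) = Module.finrank F E := by
    classical
    rw [hE, Nat.card_eq_fintype_card]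
    refine le_antisymm (hE ▸ AlgEquiv.card_le) ?_
    have h2 : ({1, σ} : Finset (E ≃ₐ[F] E)).card = 2 := Finset.card_pair hσ.symm
    exact h2 ▸ Finset.card_le_univ _
  have : IsGalois F E := IsGalois.of_card_aut_eq_finrank F E hcard
  refine Set.mem_range.mp ((IsGalois.mem_range_algebraMap_iff_fixed x).mpr fun τ => ?_)
  rcases algEquiv_eq_one_or_eq hE σ hσ τ with rfl | rfl
  · rfl
  · exact hx

end Quadratic

/-! ### Elements of even valuation are norms. -/

section ResidueField

variable {p : ℕ} [Fact p.Prime] {F : Type*} [NormedField F] [NormedAlgebra ℚ_[p] F]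
  [IsUltrametricDist F] [ProperSpace F]

/-- A unit is represented by the form `x ^ 2 - ε y ^ 2` modulo the maximal ideal. -/
theorem exists_norm_sq_sub_lt_one (hp : 2 < p) {ϖ : ringOfIntegers p F}
    (h : IsUniformizer (ϖ : F)) {ε u : F} (hε : ‖ε‖ = 1) (hu : ‖u‖ ≤ 1) :
    ∃ x y : F, ‖x‖ ≤ 1 ∧ ‖y‖ ≤ 1 ∧ ‖x ^ 2 - ε * y ^ 2 - u‖ < 1 := by
  have hmem : ∀ y : ringOfIntegers p F, y ∈ Ideal.span {ϖ} ↔ ‖(y : F)‖ < 1 := by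
    intro y
    rw [Ideal.mem_span_singleton]
    constructor
    · rintro ⟨z, rfl⟩
      rw [Subring.coe_mul, norm_mul]
      exact (mul_le_of_le_one_right (norm_nonneg _) z.2).trans_lt h.norm_lt_one
    · intro hy
      have hy' : ‖(y : F)‖ ≤ ‖(ϖ : F)‖ := by
        simpa using h.norm_le_of_lt (n := 0) (by simpa using hy)
      refine ⟨⟨(y : F) / ϖ, ?_⟩, Subtype.ext ?_⟩
      · change ‖(y : F) / ϖ‖ ≤ 1
        rw [norm_div]
        exact div_le_one_of_le₀ hy' (norm_nonneg _)
      · simp [mul_div_cancel₀ _ h.ne_zero]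
  have hmax : (Ideal.span {ϖ}).IsMaximal := by
    rw [Ideal.isMaximal_iff]
    refine ⟨?_, fun J x _ hx hxJ => ?_⟩
    · rw [hmem]
      simp
    · rw [hmem, not_lt] at hx
      have hx1 : ‖(x : F)‖ = 1 := le_antisymm x.2 hx
      have hx0 : (x : F) ≠ 0 := norm_pos_iff.mp (by rw [hx1]; exact one_pos)
      have hinv : ‖(x : F)⁻¹‖ ≤ 1 := by rw [norm_inv, hx1, inv_one]
      have : (⟨(x : F)⁻¹, hinv⟩ : ringOfIntegers p F) * x = 1 :=
        Subtype.ext (inv_mul_cancel₀ hx0)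
      rw [← this]
      exact J.mul_mem_left _ hxJ
  let _ : Field (ringOfIntegers p F ⧸ Ideal.span {ϖ}) := Ideal.Quotient.field _
  have hfin : Finite (ringOfIntegers p F ⧸ Ideal.span {ϖ}) := by
    apply Nat.finite_of_card_ne_zero
    have := residueCard_eq_relIndex h
    rw [residueCard] at this
    rw [this]
    exact h.relIndex_pos.ne'
  let _ := Fintype.ofFinite (ringOfIntegers p F ⧸ Ideal.span {ϖ})
  have hodd : Fintype.card (ringOfIntegers p F ⧸ Ideal.span {ϖ}) % 2 = 1 := by
    apply FiniteField.odd_card_of_char_ne_two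
    intro hchar
    have h2 : ((2 : ℕ) : ringOfIntegers p F ⧸ Ideal.span {ϖ}) = 0 := by
      rw [← hchar]
      exact CharP.cast_eq_zero _ _
    rw [← map_natCast (Ideal.Quotient.mk (Ideal.span {ϖ})), Ideal.Quotient.eq_zero_iff_mem,
      hmem] at h2
    have h3 : (((2 : ℕ) : ringOfIntegers p F) : F) = 2 := by
      rw [Subring.coe_natCast, Nat.cast_ofNat]
    rw [h3, norm_two_eq_one hp] at h2
    exact lt_irrefl _ h2
  let π := Ideal.Quotient.mk (Ideal.span {ϖ})
  let ε' : ringOfIntegers p F := ⟨ε, hε.le⟩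
  let u' : ringOfIntegers p F := ⟨u, hu⟩
  have hε0 : π ε' ≠ 0 := by
    rw [Ne, Ideal.Quotient.eq_zero_iff_mem, hmem]
    exact hε.not_lt
  -- Over a finite field of odd order the value sets of X² - u and of εX² have more than half the
  -- size of the field, hence they meet.
  obtain ⟨x, y, hxy⟩ := FiniteField.exists_root_sum_quadratic
    (f := Polynomial.X ^ 2 - Polynomial.C (π u'))
    (g := Polynomial.C (-π ε') * Polynomial.X ^ 2)
    (Polynomial.degree_X_pow_sub_C two_pos _)
    (Polynomial.degree_C_mul_X_pow 2 (neg_ne_zero.mpr hε0)) hodd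
  obtain ⟨x, rfl⟩ := Ideal.Quotient.mk_surjective x
  obtain ⟨y, rfl⟩ := Ideal.Quotient.mk_surjective y
  refine ⟨x, y, x.2, y.2, ?_⟩
  have h3 : x ^ 2 - ε' * y ^ 2 - u' ∈ Ideal.span {ϖ} := by
    rw [← Ideal.Quotient.eq_zero_iff_mem]
    simp only [map_sub, map_mul, map_pow]
    simp only [Polynomial.eval_sub, Polynomial.eval_pow, Polynomial.eval_X, Polynomial.eval_C,
      Polynomial.eval_mul] at hxy
    rw [← hxy]
    ring
  rw [hmem] at h3
  exact h3

/-- A unit is represented by the form `x ^ 2 - ε y ^ 2`. -/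
theorem exists_sq_sub_mul_sq_eq (hp : 2 < p) {ϖ : ringOfIntegers p F}
    (h : IsUniformizer (ϖ : F)) {ε u : F} (hε : ‖ε‖ = 1) (hu : ‖u‖ = 1) :
    ∃ x y : F, x ^ 2 - ε * y ^ 2 = u := by
  obtain ⟨x, y, hx, hy, hxy⟩ := exists_norm_sq_sub_lt_one hp h hε hu.le
  have hε0 : ε ≠ 0 := norm_pos_iff.mp (by rw [hε]; exact one_pos)
  -- One of x, y is a unit, for otherwise u would not be one. Multiplying that coordinate by a
  -- square root of an element near 1 turns the congruence into an equality.
  rcases hx.lt_or_eq with hx1 | hx1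
  · rcases hy.lt_or_eq with hy1 | hy1
    · exfalso
      have h1 : ‖x ^ 2 - ε * y ^ 2‖ < 1 := by
        refine (norm_sub_le_max_of_ultrametric _ _).trans_lt (max_lt ?_ ?_)
        · rw [norm_pow]
          exact pow_lt_one₀ (norm_nonneg _) hx1 two_ne_zero
        · rw [norm_mul, hε, one_mul, norm_pow]
          exact pow_lt_one₀ (norm_nonneg _) hy1 two_ne_zero
      have h2 : u = (x ^ 2 - ε * y ^ 2) - (x ^ 2 - ε * y ^ 2 - u) := by ring
      have h3 := norm_sub_le_max_of_ultrametric (x ^ 2 - ε * y ^ 2) (x ^ 2 - ε * y ^ 2 - u)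
      rw [← h2, hu] at h3
      exact absurd h3 (not_le.mpr (max_lt h1 hxy))
    · have hy0 : y ≠ 0 := norm_pos_iff.mp (by rw [hy1]; exact one_pos)
      obtain ⟨t, ht⟩ := exists_sq_eq_of_norm_sub_one_lt (norm_two_eq_one hp)
        (w := (x ^ 2 - u) / (ε * y ^ 2)) (by
          have : (x ^ 2 - u) / (ε * y ^ 2) - 1 = (x ^ 2 - ε * y ^ 2 - u) / (ε * y ^ 2) := by
            field_simp
            ring
          rw [this, norm_div, norm_mul, norm_pow, hε, hy1]
          simpa using hxy)
      refine ⟨x, t * y, ?_⟩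
      rw [mul_pow, ht]
      field_simp
      ring
  · have hx0 : x ≠ 0 := norm_pos_iff.mp (by rw [hx1]; exact one_pos)
    obtain ⟨t, ht⟩ := exists_sq_eq_of_norm_sub_one_lt (norm_two_eq_one hp)
      (w := (u + ε * y ^ 2) / x ^ 2) (by
        have : (u + ε * y ^ 2) / x ^ 2 - 1 = -((x ^ 2 - ε * y ^ 2 - u) / x ^ 2) := by
          field_simp
          ring
        rw [this, norm_neg, norm_div, norm_pow, hx1]
        simpa using hxy)
    refine ⟨t * x, y, ?_⟩
    rw [mul_pow, ht]
    field_simp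
    ring

variable {E : Type*} [NormedField E] [NormedAlgebra F E]

/-- In an unramified quadratic extension, an element of even valuation is a norm. -/
theorem exists_mul_conj_eq (hp : 2 < p) {ϖ : ringOfIntegers p F}
    (h : IsUniformizer (ϖ : F)) (hE : Module.finrank F E = 2) (hunr : IsUnramifiedExtension F E)
    (σ : E ≃ₐ[F] E) (hσ : σ ≠ 1) {x : F} {k : ℤ} (hx : ‖x‖ = ‖(ϖ : F)‖ ^ (2 * k)) :
    ∃ z : E, z * σ z = algebraMap F E x := by
  obtain ⟨y, hy⟩ : ∃ y : E, σ y ≠ y := by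
    by_contra hall
    push Not at hall
    exact hσ (AlgEquiv.ext hall)
  obtain ⟨n, hn⟩ := hunr (y - σ y)
  have hy0 : y - σ y ≠ 0 := sub_ne_zero.mpr (Ne.symm hy)
  have hn0 : n ≠ 0 := norm_pos_iff.mp (by rw [← hn]; exact norm_pos_iff.mpr hy0)
  have hn0' : algebraMap F E n ≠ 0 := by simpa using hn0
  -- A unit of trace zero. Unramifiedness supplies n in F with the norm of y - σ y; then ε = τ² is a
  -- unit of F, and s + tτ has norm s² - εt².
  set τ : E := (y - σ y) / algebraMap F E n with hτ
  have hτσ : σ τ = -τ := by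
    rw [hτ, map_div₀, map_sub, algEquiv_involutive hE σ hσ, AlgEquiv.commutes]
    ring
  have hτ1 : ‖τ‖ = 1 := by
    rw [hτ, norm_div, norm_algebraMap', hn, div_self (norm_pos_iff.mpr hn0).ne']
  obtain ⟨ε, hε⟩ := exists_algebraMap_eq_of_fixed hE σ hσ (x := τ ^ 2) (by rw [map_pow, hτσ]; ring)
  have hε1 : ‖ε‖ = 1 := by
    rw [← norm_algebraMap' E ε, hε, norm_pow, hτ1, one_pow]
  have hϖ := h.ne_zero
  obtain ⟨s, t, hst⟩ := exists_sq_sub_mul_sq_eq hp h hε1 (u := x * ((ϖ : F) ^ (2 * k))⁻¹) (by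
    rw [norm_mul, norm_inv, norm_zpow, hx, mul_inv_cancel₀ (zpow_pos h.norm_pos _).ne'])
  refine ⟨algebraMap F E ((ϖ : F) ^ k) * (algebraMap F E s + algebraMap F E t * τ), ?_⟩
  have hx' : x = (ϖ : F) ^ k * (ϖ : F) ^ k * (s ^ 2 - ε * t ^ 2) := by
    rw [hst, ← zpow_add₀ hϖ, ← two_mul]
    have := zpow_ne_zero (2 * k) hϖ
    field_simp
  rw [hx']
  simp only [map_mul, map_add, map_sub, map_pow, AlgEquiv.commutes, hτσ, hε]
  ring

end ResidueField

/-! ### The nonsplit condition in coordinates. -/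

section Minus

variable {F E : Type*} [NormedField F] [NormedField E] [NormedAlgebra F E]

theorem conjTr_mul {n : ℕ} (σ : E ≃ₐ[F] E) (A B : Matrix (Fin n) (Fin n) E) :
    conjTr σ (A * B) = conjTr σ B * conjTr σ A := by
  rw [conjTr, Matrix.map_mul, Matrix.transpose_mul]
  rfl

theorem IsRegularSemisimple.ne_zero {a b c d e : E}
    (h : IsRegularSemisimple !![a, b; c, d] ![0, 1] ![0, e]) : b ≠ 0 ∧ c ≠ 0 ∧ e ≠ 0 := by
  obtain ⟨h1, h2⟩ := h
  rw [linearIndependent_fin2] at h1 h2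
  simp only [Fin.val_one, pow_one, Fin.val_zero, pow_zero, Matrix.one_mulVec, Matrix.vecMul_one] at h1 h2
  have e1 : !![a, b; c, d] *ᵥ ![0, 1] = ![b, d] := by
    ext i
    fin_cases i <;> simp [Matrix.mulVec, dotProduct]
  have e2 : ![0, e] ᵥ* !![a, b; c, d] = ![e * c, e * d] := by
    ext i
    fin_cases i <;> simp [Matrix.vecMul, dotProduct]
  rw [e1] at h1
  rw [e2] at h2
  refine ⟨?_, ?_, ?_⟩
  · rintro rfl
    by_cases hd : d = 0
    · exact h1.1 (by rw [hd]; ext i; fin_cases i <;> rfl)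
    · exact h1.2 d⁻¹ (by ext i; fin_cases i <;> simp [hd])
  · rintro rfl
    by_cases hd : d = 0
    · exact h2.1 (by rw [hd]; ext i; fin_cases i <;> simp)
    · exact h2.2 d⁻¹ (by ext i; fin_cases i <;> simp [hd, mul_comm e d])
  · rintro rfl
    exact h2.1 (by ext i; fin_cases i <;> simp)

theorem mem_symmetricSpace_two {σ : E ≃ₐ[F] E} {a b c d : E} :
    !![a, b; c, d] ∈ symmetricSpace σ 2 ↔
      a * σ a + b * σ c = 1 ∧ a * σ b + b * σ d = 0 ∧ c * σ a + d * σ c = 0 ∧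
        c * σ b + d * σ d = 1 := by
  have e : (!![a, b; c, d]).map σ = !![σ a, σ b; σ c, σ d] := by
    ext i j
    fin_cases i <;> fin_cases j <;> rfl
  change !![a, b; c, d] * (!![a, b; c, d]).map σ = 1 ↔ _
  rw [e, Matrix.mul_fin_two, Matrix.one_fin_two]
  constructor
  · intro h
    have h00 := congrFun (congrFun h 0) 0
    have h01 := congrFun (congrFun h 0) 1
    have h10 := congrFun (congrFun h 1) 0
    have h11 := congrFun (congrFun h 1) 1
    exact ⟨h00, h01, h10, h11⟩
  · rintro ⟨h1, h2, h3, h4⟩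
    rw [h1, h2, h3, h4]

/-- If a Hermitian form is diagonal with isotropic vector `(1, z)`, then it is split. -/
theorem exists_conjTr_mul_eq_antidiagonal (σ : E ≃ₐ[F] E) (h2 : (2 : E) ≠ 0) {f e z : E}
    (hf : σ f = f) (hf0 : f ≠ 0) (hz : f + e * (z * σ z) = 0) :
    ∃ R : GL (Fin 2) E,
      conjTr σ (R : Matrix (Fin 2) (Fin 2) E) * !![f, 0; 0, e] * R = antidiagonal E 2 := by
  have hz0 : z ≠ 0 := by
    rintro rfl
    simp [hf0] at hz
  -- The columns are (1, z) and (1, -z)/(2f). Both are isotropic because e z σ(z) = -f, and the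
  -- factor 1/(2f) makes their pairing 1.
  have hdet : (!![1, (2 * f)⁻¹; z, -(z * (2 * f)⁻¹)]).det ≠ 0 := by
    rw [Matrix.det_fin_two_of]
    have : 1 * -(z * (2 * f)⁻¹) - (2 * f)⁻¹ * z = -(z * f⁻¹) := by
      field_simp
      ring
    rw [this]
    exact neg_ne_zero.mpr (mul_ne_zero hz0 (inv_ne_zero hf0))
  refine ⟨Matrix.GeneralLinearGroup.mkOfDetNeZero _ hdet, ?_⟩
  have hR : ((Matrix.GeneralLinearGroup.mkOfDetNeZero _ hdet : GL (Fin 2) E) :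
      Matrix (Fin 2) (Fin 2) E) = !![1, (2 * f)⁻¹; z, -(z * (2 * f)⁻¹)] := rfl
  have hc : conjTr σ !![1, (2 * f)⁻¹; z, -(z * (2 * f)⁻¹)] =
      !![1, σ z; (2 * f)⁻¹, -(σ z * (2 * f)⁻¹)] := by
    ext i j
    fin_cases i <;> fin_cases j <;> simp [conjTr, hf, map_ofNat]
  have ha : antidiagonal E 2 = !![0, 1; 1, 0] := by
    ext i j
    fin_cases i <;> fin_cases j <;> simp [antidiagonal]
  have hz' : e * (z * σ z) = -f := by linear_combination hz
  rw [hR, hc, ha, Matrix.mul_fin_two, Matrix.mul_fin_two]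
  congr 1
  simp only [mul_zero, add_zero, zero_add, one_mul, mul_one]
  ext i j
  fin_cases i <;> fin_cases j <;> simp
  · linear_combination hz
  · field_simp
    linear_combination -hz
  · field_simp
    linear_combination -hz
  · field_simp
    linear_combination hz

/-- The form J pulls back along h to a Hermitian X preserved by γ. Matching of the vectors makes X =
diag(f, e), and invariance gives f b = e c. If -c σ(b) = z σ(z), then (1, z/b) is isotropic for X,
so X, and with it J, would be split. -/
theorem mul_conj_ne_of_mem_minusLocus (σ : E ≃ₐ[F] E) (hσ : ∀ x, σ (σ x) = x) (h2 : (2 : E) ≠ 0) {a b c d : E} {e : F}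
    (hx : ((!![a, b; c, d], ![0, 1], ![0, e]) :
      Matrix (Fin 2) (Fin 2) E × (Fin 2 → F) × (Fin 2 → F)) ∈ minusLocus σ 2) :
    !![a, b; c, d] ∈ symmetricSpace σ 2 ∧ b ≠ 0 ∧ c ≠ 0 ∧ e ≠ 0 ∧
      ∀ z : E, z * σ z ≠ -(c * σ b) := by
  obtain ⟨hS, hrs, J, ⟨hJ, hJdet, hJns⟩, g, w, hg, -, h, hh1, hh2, hh3⟩ := hx
  dsimp only at hS hrs hh1 hh2 hh3
  have eu : (algebraMap F E ∘ ![0, 1] : Fin 2 → E) = ![0, 1] := by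
    ext i
    fin_cases i <;> simp
  have ev : (algebraMap F E ∘ ![0, e] : Fin 2 → E) = ![0, algebraMap F E e] := by
    ext i
    fin_cases i <;> simp
  rw [eu, ev] at hrs
  rw [ev] at hh3
  rw [eu] at hh2
  obtain ⟨hb, hc, he⟩ := hrs.ne_zero
  refine ⟨hS, hb, hc, by simpa using he, fun z hz => hJns ?_⟩
  set e' := algebraMap F E e with he'
  set X : Matrix (Fin 2) (Fin 2) E :=
    conjTr σ (h : Matrix (Fin 2) (Fin 2) E) * J * (h : Matrix (Fin 2) (Fin 2) E) with hXdef
  have hhg : (h : Matrix (Fin 2) (Fin 2) E) * !![a, b; c, d] = g * h := by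
    rw [← hh1, mul_assoc, ← Units.val_mul, inv_mul_cancel, Units.val_one, mul_one]
  have hXγ : conjTr σ !![a, b; c, d] * X * !![a, b; c, d] = X := by
    have h1 : conjTr σ !![a, b; c, d] * X * !![a, b; c, d] =
        conjTr σ ((h : Matrix (Fin 2) (Fin 2) E) * !![a, b; c, d]) * J *
          ((h : Matrix (Fin 2) (Fin 2) E) * !![a, b; c, d]) := by
      rw [conjTr_mul, hXdef]
      simp only [mul_assoc]
    rw [h1, hhg, conjTr_mul, hXdef]
    nth_rw 2 [← hg]
    simp only [mul_assoc]
  have hXX : conjTr σ X = X := by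
    have h1 : conjTr σ (conjTr σ (h : Matrix (Fin 2) (Fin 2) E)) = h := by
      ext i j
      simp [conjTr, hσ]
    rw [hXdef, conjTr_mul, conjTr_mul, h1, hJ, mul_assoc]
  -- Here h u = w and v h⁻¹ = w^*, so the functional of u under X is w^* h = v.
  have hrow : ![0, 1] ᵥ* X = ![0, e'] := by
    have h1 : σ ∘ w = ![0, 1] ᵥ* conjTr σ (h : Matrix (Fin 2) (Fin 2) E) := by
      rw [← hh2]
      ext i
      fin_cases i <;> simp [conjTr, Matrix.vecMul, dotProduct, Fin.sum_univ_two]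
    rw [hXdef, ← Matrix.vecMul_vecMul, ← Matrix.vecMul_vecMul, ← h1, ← hh3, Matrix.vecMul_vecMul,
      ← Units.val_mul, inv_mul_cancel, Units.val_one, Matrix.vecMul_one]
  have h10 : X 1 0 = 0 := by
    have := congrFun hrow 0
    simpa [Matrix.vecMul, dotProduct, Fin.sum_univ_two] using this
  have h11 : X 1 1 = e' := by
    have := congrFun hrow 1
    simpa [Matrix.vecMul, dotProduct, Fin.sum_univ_two] using this
  have h01 : X 0 1 = 0 := by
    have := congrFun (congrFun hXX 0) 1
    rw [← this]
    simp [conjTr, h10]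
  have h00 : σ (X 0 0) = X 0 0 := congrFun (congrFun hXX 0) 0
  have hX : X = !![X 0 0, 0; 0, e'] := by
    nth_rw 1 [Matrix.eta_fin_two X]
    rw [h01, h10, h11]
  set f := X 0 0 with hf
  have hσb : σ b ≠ 0 := by simpa using hb
  obtain ⟨-, -, -, hS4⟩ := mem_symmetricSpace_two.mp hS
  -- Compare the lower right entry of γ^* X γ = X with c σ(b) + d σ(d) = 1, and cancel σ(b).
  have hfb : f * b = e' * c := by
    have hγ : conjTr σ !![a, b; c, d] = !![σ a, σ c; σ b, σ d] := by
      ext i j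
      fin_cases i <;> fin_cases j <;> rfl
    rw [hγ, hX, Matrix.mul_fin_two, Matrix.mul_fin_two] at hXγ
    have := congrFun (congrFun hXγ 1) 1
    simp at this
    apply mul_right_cancel₀ hσb
    linear_combination this - e' * hS4
  have hf0 : f ≠ 0 := by
    intro h0
    rw [h0, zero_mul] at hfb
    exact mul_ne_zero he hc hfb.symm
  obtain ⟨R, hR⟩ := exists_conjTr_mul_eq_antidiagonal σ h2 (f := f) (e := e') (z := z / b) h00 hf0
    (by
      rw [map_div₀, div_mul_div_comm, hz]
      field_simp
      linear_combination hfb)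
  refine ⟨h * R, ?_⟩
  rw [← hR, ← hX, Units.val_mul, conjTr_mul, hXdef]
  simp only [mul_assoc]

end Minus

/-! ### Counting solutions of the quadratic inequality modulo ϖ^n. -/

section Counting

variable {F : Type*} [NormedField F] {ϖ : F}

theorem IsUniformizer.quadratic_le_iff (h : IsUniformizer ϖ) {C D y₁ y₂ : F} {vb vc r m n : ℤ}
    (hC : ‖C‖ = ‖ϖ‖ ^ (vc - vb)) (hs : y₁ + y₂ = D) (hp : y₁ * y₂ = -C) (t : F) :
    ‖ϖ ^ m + t * D - t ^ 2 * C * (ϖ ^ m)⁻¹‖ ≤ ‖ϖ‖ ^ (n - r - vb) ↔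
      ‖t - ϖ ^ m * y₁ / C‖ * ‖t - ϖ ^ m * y₂ / C‖ ≤ ‖ϖ‖ ^ (m + n - r - vc) := by
  have hpos := h.norm_pos
  have hC0 : C ≠ 0 := norm_pos_iff.mp (by rw [hC]; exact zpow_pos hpos _)
  have hm : ϖ ^ m ≠ 0 := zpow_ne_zero m h.ne_zero
  have e : ϖ ^ m + t * D - t ^ 2 * C * (ϖ ^ m)⁻¹ =
      -(C * (ϖ ^ m)⁻¹) * ((t - ϖ ^ m * y₁ / C) * (t - ϖ ^ m * y₂ / C)) := by
    have : C = -(y₁ * y₂) := by rw [hp, neg_neg]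
    rw [← hs]
    field_simp
    rw [this]
    ring
  have hn : ‖C * (ϖ ^ m)⁻¹‖ = ‖ϖ‖ ^ (vc - vb - m) := by
    rw [norm_mul, hC, norm_inv, norm_zpow, ← zpow_neg, ← zpow_add₀ hpos.ne', ← sub_eq_add_neg]
  rw [e, norm_mul, norm_neg, hn, ← norm_mul,
    show n - r - vb = (vc - vb - m) + (m + n - r - vc) by ring, zpow_add₀ hpos.ne',
    mul_le_mul_iff_right₀ (zpow_pos hpos _)]

variable [IsUltrametricDist F]

theorem IsUniformizer.norm_add_sub_le_iff (h : IsUniformizer ϖ) {x y z : F} {i j : ℤ}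
    (hx : ‖x‖ = ‖ϖ‖ ^ i) (hy : ‖y‖ = ‖ϖ‖ ^ j) (hij : i ≠ j)
    (hz : ‖z‖ < max ‖x‖ ‖y‖) {N : ℤ} :
    ‖x + z - y‖ ≤ ‖ϖ‖ ^ N ↔ N ≤ i ∧ N ≤ j := by
  have hne : ‖x‖ ≠ ‖-y‖ := by
    rw [norm_neg, hx, hy, Ne, h.zpow_inj]
    exact hij
  have h1 : ‖x + -y‖ = max ‖x‖ ‖y‖ := by
    rw [IsUltrametricDist.norm_add_eq_max_of_norm_ne_norm hne, norm_neg]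
  have h2 : ‖x + z - y‖ = max ‖x‖ ‖y‖ := by
    rw [show x + z - y = (x + -y) + z by ring,
      IsUltrametricDist.norm_add_eq_max_of_norm_ne_norm (by rw [h1]; exact hz.ne'), h1]
    exact max_eq_left hz.le
  rw [h2, max_le_iff, hx, hy, h.zpow_le_zpow, h.zpow_le_zpow]

/-- The solutions of a quadratic inequality whose middle coefficient is small. -/
theorem IsUniformizer.setOf_quadratic_le_eq (h : IsUniformizer ϖ) {C D : F} {vb vc r m n : ℤ}
    (hC : ‖C‖ = ‖ϖ‖ ^ (vc - vb)) (hodd : Odd (vb + vc))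
    (hD : D = 0 ∨ ∃ δ : ℤ, ‖D‖ = ‖ϖ‖ ^ (δ - vb) ∧ vb + vc < 2 * δ) :
    {t : F | ‖t‖ ≤ 1 ∧ ‖ϖ ^ m + t * D - t ^ 2 * C * (ϖ ^ m)⁻¹‖ ≤ ‖ϖ‖ ^ (n - r - vb)} =
      if n - r ≤ m + vb then {t | ‖t - 0‖ ≤ ‖ϖ‖ ^ max 0 (-((vc + r - (m + n)) / 2))} else ∅ := by
  have hp := h.norm_pos
  have key : ∀ t : F, ‖t‖ ≤ 1 ∧ ‖ϖ ^ m + t * D - t ^ 2 * C * (ϖ ^ m)⁻¹‖ ≤ ‖ϖ‖ ^ (n - r - vb) ↔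
      n - r ≤ m + vb ∧ ‖t - 0‖ ≤ ‖ϖ‖ ^ max 0 (-((vc + r - (m + n)) / 2)) := by
    intro t
    rw [sub_zero]
    by_cases ht : t = 0
    · subst ht
      simp only [norm_zero, zero_le_one, true_and, zero_mul, add_zero, ne_eq, OfNat.ofNat_ne_zero,
        not_false_eq_true, zero_pow, sub_zero, norm_zpow, h.zpow_le_zpow, zpow_nonneg hp.le,
        and_true]
      omega
    · obtain ⟨τ, hτ⟩ := h.exists_zpow t ht
      have hx : ‖ϖ ^ m‖ = ‖ϖ‖ ^ m := norm_zpow _ _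
      have hy : ‖t ^ 2 * C * (ϖ ^ m)⁻¹‖ = ‖ϖ‖ ^ (2 * τ + (vc - vb) - m) := by
        rw [norm_mul, norm_mul, norm_pow, hτ, hC, norm_inv, norm_zpow, ← zpow_natCast, ← zpow_mul,
          ← zpow_add₀ hp.ne', ← zpow_neg, ← zpow_add₀ hp.ne']
        congr 1
        push_cast
        ring
      obtain ⟨w, hw⟩ := hodd
      -- The condition v(b) + v(c) < 2δ says that the valuation of tD exceeds the average of those
      -- of the outer terms. Those two have odd sum, so they differ and cannot cancel.
      have hz : ‖t * D‖ < max ‖ϖ ^ m‖ ‖t ^ 2 * C * (ϖ ^ m)⁻¹‖ := by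
        rcases hD with rfl | ⟨δ, hδ, hlt⟩
        · rw [mul_zero, norm_zero, hx]
          exact lt_max_of_lt_left (zpow_pos hp m)
        · rw [norm_mul, hτ, hδ, ← zpow_add₀ hp.ne', hx, hy, lt_max_iff, h.zpow_lt_zpow,
            h.zpow_lt_zpow]
          omega
      rw [h.norm_add_sub_le_iff hx hy (by omega) hz, hτ, h.zpow_le_one, h.zpow_le_zpow]
      omega
  ext t
  rw [Set.mem_ofPred_eq, key]
  split_ifs with hc <;> simp [hc]

/-- Factorisation of a quadratic polynomial whose middle coefficient dominates. -/
theorem exists_roots_of_norm_lt [ProperSpace F] (h2 : ‖(2 : F)‖ = 1) {C D : F} (hD : D ≠ 0)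
    (hCD : ‖C‖ < ‖D‖ ^ 2) :
    ∃ y₁ y₂ : F, y₁ + y₂ = D ∧ y₁ * y₂ = -C ∧ ‖y₂‖ = ‖D‖ := by
  have h20 : (2 : F) ≠ 0 := norm_pos_iff.mp (by rw [h2]; exact one_pos)
  have hDp : 0 < ‖D‖ ^ 2 := pow_pos (norm_pos_iff.mpr hD) 2
  have hw : ‖(1 + 2 * 2 * (C / D ^ 2)) - 1‖ < 1 := by
    rw [add_sub_cancel_left, norm_mul, norm_mul, h2, one_mul, one_mul, norm_div, norm_pow,
      div_lt_one hDp]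
    exact hCD
  obtain ⟨s, hs⟩ := exists_sq_eq_of_norm_sub_one_lt h2 hw
  -- Choose the sign of the root so that s is near 1: the product (s - 1)(s + 1) has norm less than
  -- 1, so one factor does. Then 1 + s is a unit, which fixes the norm of y₂.
  obtain ⟨s, hs, hs1⟩ : ∃ s : F, s ^ 2 = 1 + 2 * 2 * (C / D ^ 2) ∧ ‖s - 1‖ < 1 := by
    have h1 : (s - 1) * (s + 1) = (1 + 2 * 2 * (C / D ^ 2)) - 1 := by
      rw [← hs]
      ring
    rw [← h1, norm_mul] at hw
    by_cases hlt : ‖s - 1‖ < 1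
    · exact ⟨s, hs, hlt⟩
    · refine ⟨-s, by rw [neg_sq, hs], ?_⟩
      rw [show -s - 1 = -(s + 1) by ring, norm_neg]
      push Not at hlt
      by_contra hge
      push Not at hge
      nlinarith [norm_nonneg (s - 1)]
  have hs2 : ‖1 + s‖ = 1 := by
    rw [show 1 + s = 2 + (s - 1) by ring,
      IsUltrametricDist.norm_add_eq_max_of_norm_ne_norm (by rw [h2]; exact hs1.ne'), h2]
    exact max_eq_left hs1.le
  refine ⟨D * (1 - s) / 2, D * (1 + s) / 2, by field_simp; ring, ?_, ?_⟩
  · have : D * (1 - s) / 2 * (D * (1 + s) / 2) = D ^ 2 * (1 - s ^ 2) / (2 * 2) := by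
      field_simp
      ring
    rw [this, hs]
    field_simp
    ring
  · rw [norm_div, norm_mul, hs2, h2, mul_one, div_one]

/-- The solutions of `|t - t₁| |t - t₂| ≤ |ϖ| ^ R` form a ball if the radius is large. -/
theorem IsUniformizer.norm_mul_norm_le_iff_of_le (h : IsUniformizer ϖ) {t₁ t₂ : F} {w₁ w₂ R : ℤ}
    (h1 : ‖t₁‖ = ‖ϖ‖ ^ w₁) (h2 : ‖t₂‖ = ‖ϖ‖ ^ w₂) (hw : w₂ < w₁) (hR : R ≤ 2 * w₂) (t : F) :
    ‖t - t₁‖ * ‖t - t₂‖ ≤ ‖ϖ‖ ^ R ↔ ‖t‖ ≤ ‖ϖ‖ ^ (-(-R / 2)) := by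
  have hp := h.norm_pos
  -- Below |t₂| both factors are at most |t₂|, which suffices; above it both equal |t|.
  by_cases ht : ‖t‖ ≤ ‖ϖ‖ ^ w₂
  · have a1 : ‖t - t₁‖ ≤ ‖ϖ‖ ^ w₂ := (norm_sub_le_max_of_ultrametric _ _).trans
      (max_le ht (by rw [h1, h.zpow_le_zpow]; exact hw.le))
    have a2 : ‖t - t₂‖ ≤ ‖ϖ‖ ^ w₂ := (norm_sub_le_max_of_ultrametric _ _).trans
      (max_le ht h2.le)
    refine iff_of_true ?_ (ht.trans (h.zpow_le_zpow.mpr (by omega)))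
    calc ‖t - t₁‖ * ‖t - t₂‖ ≤ ‖ϖ‖ ^ w₂ * ‖ϖ‖ ^ w₂ := by gcongr
      _ = ‖ϖ‖ ^ (2 * w₂) := by rw [← zpow_add₀ hp.ne', two_mul]
      _ ≤ ‖ϖ‖ ^ R := h.zpow_le_zpow.mpr hR
  · push Not at ht
    have ht0 : t ≠ 0 := norm_pos_iff.mp ((zpow_pos hp _).trans ht)
    obtain ⟨τ, hτ⟩ := h.exists_zpow t ht0
    rw [hτ, h.zpow_lt_zpow] at ht
    have a : ∀ u : F, ‖u‖ < ‖t‖ → ‖t - u‖ = ‖t‖ := by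
      intro u hu
      rw [sub_eq_add_neg, IsUltrametricDist.norm_add_eq_max_of_norm_ne_norm
        (by rw [norm_neg]; exact hu.ne'), norm_neg]
      exact max_eq_left hu.le
    rw [a t₁ (by rw [h1, hτ, h.zpow_lt_zpow]; omega), a t₂ (by rw [h2, hτ, h.zpow_lt_zpow]; omega),
      hτ, ← zpow_add₀ hp.ne', h.zpow_le_zpow, h.zpow_le_zpow]
    omega

/-- The solutions of `|t - t₁| |t - t₂| ≤ |ϖ| ^ R` form two balls if the radius is small. -/
theorem IsUniformizer.norm_mul_norm_le_iff_of_lt (h : IsUniformizer ϖ) {t₁ t₂ : F} {w R : ℤ}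
    (h12 : ‖t₁ - t₂‖ = ‖ϖ‖ ^ w) (hR : 2 * w < R) (t : F) :
    ‖t - t₁‖ * ‖t - t₂‖ ≤ ‖ϖ‖ ^ R ↔ ‖t - t₁‖ ≤ ‖ϖ‖ ^ (R - w) ∨ ‖t - t₂‖ ≤ ‖ϖ‖ ^ (R - w) := by
  have hp := h.norm_pos
  have key : ∀ x y : F, ‖x - y‖ = ‖ϖ‖ ^ w → ‖x‖ < ‖ϖ‖ ^ w → ‖y‖ = ‖ϖ‖ ^ w := by
    intro x y hxy hx
    rw [show y = x + -(x - y) by ring, IsUltrametricDist.norm_add_eq_max_of_norm_ne_norm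
      (by rw [norm_neg, hxy]; exact hx.ne), norm_neg, hxy]
    exact max_eq_right hx.le
  -- A point closer to one root than the distance between the roots is at exactly that distance from
  -- the other.
  have key2 : ∀ x y : F, ‖x - y‖ = ‖ϖ‖ ^ w → ‖x‖ < ‖ϖ‖ ^ w →
      (‖x‖ * ‖y‖ ≤ ‖ϖ‖ ^ R ↔ ‖x‖ ≤ ‖ϖ‖ ^ (R - w)) := by
    intro x y hxy hx
    rw [key x y hxy hx, zpow_sub₀ hp.ne', le_div_iff₀ (zpow_pos hp w)]
  have e12 : ‖(t - t₂) - (t - t₁)‖ = ‖ϖ‖ ^ w := by rw [← h12]; congr 1; ring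
  have e21 : ‖(t - t₁) - (t - t₂)‖ = ‖ϖ‖ ^ w := by rw [← e12, norm_sub_rev]
  have hlt : ‖ϖ‖ ^ (R - w) < ‖ϖ‖ ^ w := h.zpow_lt_zpow.mpr (by omega)
  constructor
  · intro hle
    by_cases c1 : ‖t - t₁‖ < ‖ϖ‖ ^ w
    · exact Or.inl ((key2 _ _ e21 c1).mp hle)
    · by_cases c2 : ‖t - t₂‖ < ‖ϖ‖ ^ w
      · exact Or.inr ((key2 _ _ e12 c2).mp (by rwa [mul_comm]))
      · exfalso
        push Not at c1 c2
        have h3 : ‖ϖ‖ ^ w * ‖ϖ‖ ^ w ≤ ‖t - t₁‖ * ‖t - t₂‖ := by gcongr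
        rw [← zpow_add₀ hp.ne'] at h3
        have := h.zpow_le_zpow.mp (h3.trans hle)
        omega
  · rintro (c | c)
    · exact (key2 _ _ e21 (c.trans_lt hlt)).mpr c
    · rw [mul_comm]
      exact (key2 _ _ e12 (c.trans_lt hlt)).mpr c

theorem IsUniformizer.setOf_norm_le_one_and_eq (h : IsUniformizer ϖ) {t₀ : F} {w ρ : ℤ}
    (h0 : ‖t₀‖ = ‖ϖ‖ ^ w) :
    {t : F | ‖t‖ ≤ 1 ∧ ‖t - t₀‖ ≤ ‖ϖ‖ ^ ρ} =
      if min 0 ρ ≤ w then (if 0 ≤ ρ then {t | ‖t - t₀‖ ≤ ‖ϖ‖ ^ ρ} else {t | ‖t - 0‖ ≤ ‖ϖ‖ ^ (0 : ℤ)})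
      else ∅ := by
  ext t
  rw [Set.mem_ofPred_eq]
  split_ifs with h1 h2
  · rw [Set.mem_ofPred_eq, and_iff_right_iff_imp]
    intro ht
    rw [show t = (t - t₀) + t₀ by ring]
    refine (IsUltrametricDist.norm_add_le_max _ _).trans (max_le (ht.trans ?_) ?_)
    · exact h.zpow_le_one.mpr h2
    · rw [h0]
      exact h.zpow_le_one.mpr (by omega)
  · rw [Set.mem_ofPred_eq, sub_zero, zpow_zero, and_iff_left_iff_imp]
    intro ht
    refine (norm_sub_le_max_of_ultrametric _ _).trans (max_le (ht.trans ?_) ?_)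
    · rw [← zpow_zero ‖ϖ‖, h.zpow_le_zpow]
      omega
    · rw [h0, h.zpow_le_zpow]
      omega
  · simp only [Set.mem_empty_iff_false, iff_false, not_and]
    intro ht ht2
    refine h1 ?_
    rw [← h.zpow_le_zpow, ← h0, show t₀ = t - (t - t₀) by ring]
    refine (norm_sub_le_max_of_ultrametric _ _).trans (max_le (ht.trans ?_) (ht2.trans ?_))
    · rw [← zpow_zero ‖ϖ‖, h.zpow_le_zpow]
      omega
    · rw [h.zpow_le_zpow]
      omega

/-- The residue cardinality, as an index. -/
noncomputable def idealIndex (ϖ : F) : ℕ := (fracIdeal ϖ 1).relIndex (fracIdeal ϖ 0)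

theorem IsUniformizer.ncard_image_ball_eq_zpow (h : IsUniformizer ϖ) (x₀ : F) {ρ n : ℤ}
    (hρ : ρ ≤ n) :
    (((QuotientAddGroup.mk : F → F ⧸ fracIdeal ϖ n) '' {t | ‖t - x₀‖ ≤ ‖ϖ‖ ^ ρ}).ncard : ℂ) =
      (idealIndex ϖ : ℂ) ^ (n - ρ) := by
  rw [h.ncard_image_ball x₀ hρ, ← idealIndex, Nat.cast_pow, ← zpow_natCast,
    Int.toNat_of_nonneg (by omega)]

theorem IsUniformizer.ncard_quadratic_of_lt (h : IsUniformizer ϖ) {C D : F} {vb vc r m n : ℤ}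
    (hC : ‖C‖ = ‖ϖ‖ ^ (vc - vb)) (hodd : Odd (vb + vc))
    (hD : D = 0 ∨ ∃ δ : ℤ, ‖D‖ = ‖ϖ‖ ^ (δ - vb) ∧ vb + vc < 2 * δ)
    (hn : 0 ≤ n) (hm : m ≤ n + vc + r) :
    (((QuotientAddGroup.mk : F → F ⧸ fracIdeal ϖ n) ''
      {t : F | ‖t‖ ≤ 1 ∧ ‖ϖ ^ m + t * D - t ^ 2 * C * (ϖ ^ m)⁻¹‖ ≤ ‖ϖ‖ ^ (n - r - vb)}).ncard : ℂ) =
      if n - r ≤ m + vb then (idealIndex ϖ : ℂ) ^ (n - max 0 (-((vc + r - (m + n)) / 2))) else 0 := by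
  rw [h.setOf_quadratic_le_eq hC hodd hD]
  split_ifs
  · exact h.ncard_image_ball_eq_zpow 0 (by omega)
  · simp

/-- With m fixed there are three regimes. For small n the solutions are a ball about 0 cut to 𝒪_F.
Once the balls about the roots t₁, t₂ separate but still have radius at least 1, the ball about t₂
misses 𝒪_F, and that about t₁ contains 𝒪_F or misses it. For n > r + δ the radius is less than 1,
and each root lying in 𝒪_F contributes its own ball. -/
theorem IsUniformizer.ncard_quadratic_of_gt [ProperSpace F] (h : IsUniformizer ϖ)
    (h2 : ‖(2 : F)‖ = 1) {C D : F}
    {vb vc r m n δ : ℤ} (hC : ‖C‖ = ‖ϖ‖ ^ (vc - vb)) (hD : ‖D‖ = ‖ϖ‖ ^ (δ - vb))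
    (hδ : 2 * δ < vb + vc) (hδ0 : 0 ≤ δ) (hr : 0 ≤ r) (hn : 0 ≤ n) (hm : m ≤ n + vc + r) :
    (((QuotientAddGroup.mk : F → F ⧸ fracIdeal ϖ n) ''
      {t : F | ‖t‖ ≤ 1 ∧ ‖ϖ ^ m + t * D - t ^ 2 * C * (ϖ ^ m)⁻¹‖ ≤ ‖ϖ‖ ^ (n - r - vb)}).ncard : ℂ) =
      if n - m ≤ 2 * δ + r - vc then
        (idealIndex ϖ : ℂ) ^ (n - max 0 (-((vc + r - (m + n)) / 2)))
      else if n ≤ r + δ then (if n - m ≤ vb + r then (idealIndex ϖ : ℂ) ^ n else 0)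
      else ((if δ - vb ≤ m then 1 else 0) + (if vc - δ ≤ m then 1 else 0)) *
        (idealIndex ϖ : ℂ) ^ (r + δ) := by
  have hp := h.norm_pos
  have hD0 : D ≠ 0 := norm_pos_iff.mp (by rw [hD]; exact zpow_pos hp _)
  obtain ⟨y₁, y₂, hs, hpr, hy₂⟩ := exists_roots_of_norm_lt h2 (C := C) hD0 (by
    rw [hC, hD, ← zpow_natCast, ← zpow_mul, h.zpow_lt_zpow]
    push_cast
    omega)
  rw [hD] at hy₂
  have hy₁ : ‖y₁‖ = ‖ϖ‖ ^ (vc - δ) := by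
    have := congrArg norm hpr
    rw [norm_mul, norm_neg, hy₂, hC, show vc - vb = (vc - δ) + (δ - vb) by ring,
      zpow_add₀ hp.ne'] at this
    exact mul_right_cancel₀ (zpow_pos hp _).ne' this
  simp only [h.quadratic_le_iff hC hs hpr]
  have hn₁ : ‖ϖ ^ m * y₁ / C‖ = ‖ϖ‖ ^ (m + vb - δ) := by
    rw [norm_div, norm_mul, norm_zpow, hy₁, hC, ← zpow_add₀ hp.ne', ← zpow_sub₀ hp.ne']
    congr 1
    ring
  have hn₂ : ‖ϖ ^ m * y₂ / C‖ = ‖ϖ‖ ^ (m + δ - vc) := by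
    rw [norm_div, norm_mul, norm_zpow, hy₂, hC, ← zpow_add₀ hp.ne', ← zpow_sub₀ hp.ne']
    congr 1
    ring
  set t₁ := ϖ ^ m * y₁ / C
  set t₂ := ϖ ^ m * y₂ / C
  have hd : ‖t₁ - t₂‖ = ‖ϖ‖ ^ (m + δ - vc) := by
    have hlt : ‖t₁‖ < ‖-t₂‖ := by
      rw [norm_neg, hn₁, hn₂, h.zpow_lt_zpow]
      omega
    rw [sub_eq_add_neg, IsUltrametricDist.norm_add_eq_max_of_norm_ne_norm hlt.ne,
      max_eq_right hlt.le, norm_neg, hn₂]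
  by_cases c1 : n - m ≤ 2 * δ + r - vc
  · rw [if_pos c1]
    simp only [h.norm_mul_norm_le_iff_of_le hn₁ hn₂ (by omega)
      (show m + n - r - vc ≤ 2 * (m + δ - vc) by omega)]
    have e : {t : F | ‖t‖ ≤ 1 ∧ ‖t‖ ≤ ‖ϖ‖ ^ (-(-(m + n - r - vc) / 2))} =
        {t | ‖t - 0‖ ≤ ‖ϖ‖ ^ max 0 (-((vc + r - (m + n)) / 2))} := by
      ext t
      rw [Set.mem_ofPred_eq, Set.mem_ofPred_eq, sub_zero,
        show -(m + n - r - vc) = vc + r - (m + n) by ring]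
      rcases le_total 0 (-((vc + r - (m + n)) / 2)) with hc | hc
      · rw [max_eq_right hc, and_iff_right_iff_imp]
        exact fun ht => ht.trans (h.zpow_le_one.mpr hc)
      · rw [max_eq_left hc, zpow_zero, and_iff_left_iff_imp]
        intro ht
        refine ht.trans ?_
        rw [← zpow_zero ‖ϖ‖, h.zpow_le_zpow]
        exact hc
    rw [e]
    exact h.ncard_image_ball_eq_zpow 0 (by omega)
  rw [if_neg c1]
  simp only [h.norm_mul_norm_le_iff_of_lt hd (show 2 * (m + δ - vc) < m + n - r - vc by omega),
    show m + n - r - vc - (m + δ - vc) = n - r - δ by ring, and_or_left, Set.ofPred_or,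
    h.setOf_norm_le_one_and_eq hn₁, h.setOf_norm_le_one_and_eq hn₂]
  by_cases c2 : n ≤ r + δ
  · rw [if_pos c2, if_neg (show ¬ min 0 (n - r - δ) ≤ m + δ - vc by omega), Set.union_empty]
    by_cases c3 : n - m ≤ vb + r
    · rw [if_pos c3, if_pos (show min 0 (n - r - δ) ≤ m + vb - δ by omega)]
      split_ifs with c4
      · rw [h.ncard_image_ball_eq_zpow _ (by omega)]
        congr 1
        omega
      · rw [h.ncard_image_ball_eq_zpow _ (by omega), sub_zero]
    · rw [if_neg c3, if_neg (show ¬ min 0 (n - r - δ) ≤ m + vb - δ by omega)]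
      simp
  · rw [if_neg c2]
    simp only [if_pos (show 0 ≤ n - r - δ by omega),
      show min 0 (n - r - δ) = 0 from min_eq_left (by omega)]
    have hb : ∀ x₀ : F, (((QuotientAddGroup.mk : F → F ⧸ fracIdeal ϖ n) ''
        {t | ‖t - x₀‖ ≤ ‖ϖ‖ ^ (n - r - δ)}).ncard : ℂ) = (idealIndex ϖ : ℂ) ^ (r + δ) := by
      intro x₀
      rw [h.ncard_image_ball_eq_zpow _ (by omega)]
      congr 1
      ring
    have hfin : ∀ x₀ : F, ((QuotientAddGroup.mk : F → F ⧸ fracIdeal ϖ n) ''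
        {t | ‖t - x₀‖ ≤ ‖ϖ‖ ^ (n - r - δ)}).Finite := fun x₀ =>
      h.finite_image_ball x₀ (by omega)
    -- The classes modulo ϖ^n are disjoint too, as each ball is a union of such classes and |t₁ -
    -- t₂| exceeds the radius.
    have hdisj : Disjoint ((QuotientAddGroup.mk : F → F ⧸ fracIdeal ϖ n) ''
        {t | ‖t - t₁‖ ≤ ‖ϖ‖ ^ (n - r - δ)}) ((QuotientAddGroup.mk : F → F ⧸ fracIdeal ϖ n) ''
        {t | ‖t - t₂‖ ≤ ‖ϖ‖ ^ (n - r - δ)}) := by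
      rw [Set.disjoint_left]
      rintro _ ⟨x, hx, rfl⟩ ⟨y, hy, hxy⟩
      rw [QuotientAddGroup.eq_iff_sub_mem, mem_fracIdeal] at hxy
      have h3 : ‖t₁ - t₂‖ ≤ ‖ϖ‖ ^ (n - r - δ) := by
        rw [show t₁ - t₂ = (y - t₂) - ((y - x) + (x - t₁)) by ring]
        refine (norm_sub_le_max_of_ultrametric _ _).trans (max_le hy
          ((IsUltrametricDist.norm_add_le_max _ _).trans (max_le (hxy.trans ?_) hx)))
        rw [h.zpow_le_zpow]
        omega
      rw [hd, h.zpow_le_zpow] at h3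
      omega
    have i1 : (0 ≤ m + vb - δ) ↔ δ - vb ≤ m := by omega
    have i2 : (0 ≤ m + δ - vc) ↔ vc - δ ≤ m := by omega
    simp only [i1, i2]
    split_ifs
    · rw [Set.image_union, Set.ncard_union_eq hdisj (hfin _) (hfin _), Nat.cast_add, hb, hb]
      ring
    · rw [Set.union_empty, hb]
      ring
    · rw [Set.empty_union, hb]
      ring
    · simp

end Counting

/-! ### Summation over n for fixed k. -/

section Combinatorics

/-- Let n₀ = max(0, ⌈(k - vc - r)/2⌉) be the least admissible n. The exponents n - n₀ run from 0 to
min(ve, ⌊(k + vb + r)/2⌋) - n₀; expanding the difference gives the terms of n(k), where oddness of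
vb + vc makes the difference of the two rounded halves equal to (vb + vc - 1)/2 + r. The term δ + r
of N is never smaller than this. -/
theorem sum_zpow_eq_of_lt (X : ℂ) {vb vc ve r k : ℤ} {δ : WithTop ℤ} (hodd : Odd (vb + vc))
    (hδ : ∀ δ' : ℤ, δ = δ' → vb + vc < 2 * δ') :
    ∑ n ∈ Finset.Icc 0 ve, (if k ≤ 2 * n + vc + r then
      (if n - r ≤ k - n + vb then X ^ (n - max 0 (-((vc + r - k) / 2))) else 0) else 0) =
      ∑ j ∈ Finset.Icc 0 (nFun vb vc ve δ r k), X ^ j := by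
  obtain ⟨w, hw⟩ := hodd
  have hN : bigN vb vc ve r δ = min ve ((vb + vc - 1) / 2 + r) := by
    cases δ with
    | top => rfl
    | coe δ =>
      have := hδ δ rfl
      change min ve (min ((vb + vc - 1) / 2 + r) (δ + r)) = _
      omega
  simp only [← ite_and]
  rw [← Finset.sum_filter]
  refine Finset.sum_nbij' (fun n => n - max 0 (-((vc + r - k) / 2)))
    (fun j => j + max 0 (-((vc + r - k) / 2))) ?_ ?_ ?_ ?_ ?_
  · intro n hn
    simp only [Finset.mem_filter, Finset.mem_Icc] at hn
    rw [Finset.mem_Icc, nFun, hN]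
    omega
  · intro j hj
    rw [Finset.mem_Icc, nFun, hN] at hj
    simp only [Finset.mem_filter, Finset.mem_Icc]
    omega
  · intro n _
    ring
  · intro n _
    ring
  · intro n _
    rfl

/-- The left side counts the n at which a ball contributes q^(δ+r). On the right are the top term of
the geometric sum and c(k), in coordinates with vb + vc = 2w + 1 and k + vb + r = 2y + s, where
halves are integral and vb drops out. `toNat` accounts for empty intervals. -/
theorem toNat_add_toNat_eq_of_halves {w ve r y δ s : ℤ} (hs : s = 0 ∨ s = 1) (hr : 0 ≤ r)
    (hδ0 : 0 ≤ δ) (hδ : δ ≤ w) (hve : 0 ≤ ve) :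
    ((min ve (2 * y + s - r - δ) + 1 - (max 0 (y - w - r) + δ + r)).toNat : ℤ) +
      (min ve (2 * y + s - r + δ - 2 * w - 1) + 1 -
        max (max 0 (y - w - r)) (y - w + δ + s)).toNat =
      (if δ + r ≤ min y (ve + w + r - y) ∧ δ + r ≤ ve then 1 else 0) +
      if 2 * δ + 2 * r ≤ 2 * y + s ∧ 2 * y + s ≤ 2 * ve + 2 * w + 1 - 2 * δ ∧ δ < ve - r then
        min (2 * y + s - 2 * δ - 2 * r) (min (2 * ve + 2 * w + 1 - 2 * δ - (2 * y + s)) (ve - δ - r))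
      else 0 := by
  have hmin : ∀ a b : ℤ, a ≤ b ∧ min a b = a ∨ b < a ∧ min a b = b := fun a b => by omega
  have hnat : ∀ a : ℤ, 0 ≤ a ∧ (a.toNat : ℤ) = a ∨ a < 0 ∧ (a.toNat : ℤ) = 0 := fun a => by omega
  rcases le_total (y - w - r) 0 with hc | hc
  · rw [max_eq_left hc]
    rcases hmin ve (2 * y + s - r - δ) with ⟨h1, e1⟩ | ⟨h1, e1⟩ <;>
    rcases hmin ve (2 * y + s - r + δ - 2 * w - 1) with ⟨h2, e2⟩ | ⟨h2, e2⟩ <;>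
    rw [e1, e2] <;>
    rcases hnat (ve + 1 - (0 + δ + r)) with ⟨h3, e3⟩ | ⟨h3, e3⟩ <;>
    rcases hnat (2 * y + s - r - δ + 1 - (0 + δ + r)) with ⟨h4, e4⟩ | ⟨h4, e4⟩ <;>
    simp only [e3, e4] <;>
    split_ifs <;> clear hmin hnat e1 e2 e3 e4 <;> omega
  · rw [max_eq_right hc, max_eq_right (show y - w - r ≤ y - w + δ + s by omega)]
    rcases hmin ve (2 * y + s - r - δ) with ⟨h1, e1⟩ | ⟨h1, e1⟩ <;>
    rcases hmin ve (2 * y + s - r + δ - 2 * w - 1) with ⟨h2, e2⟩ | ⟨h2, e2⟩ <;>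
    rw [e1, e2] <;>
    split_ifs <;> clear hmin hnat e1 e2 <;> omega

theorem toNat_add_toNat_eq {vb vc ve r k δ w n₀ : ℤ} (hw : vb + vc = 2 * w + 1) (hr : 0 ≤ r)
    (hδ0 : 0 ≤ δ) (hδ : 2 * δ < vb + vc) (hve : 0 ≤ ve)
    (hn₀ : n₀ = max 0 (-((vc + r - k) / 2))) :
    ((min ve (k - δ + vb) + 1 - (n₀ + δ + r)).toNat : ℤ) +
      (min ve (k + δ - vc) + 1 - max n₀ ((k - vc + 2 * δ + r) / 2 + 1)).toNat =
      (if δ + r ≤ min ((k + (vb + r)) / 2) (min (((2 * ve + vc + r) - k) / 2)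
        (min ve (min ((vb + vc - 1) / 2 + r) (δ + r)))) then 1 else 0) +
      if 2 * δ - vb + r ≤ k ∧ k ≤ 2 * ve + vc - 2 * δ - r then
        if δ < ve - r ∧ vb + vc > 2 * δ then
          min (k - (2 * δ - vb + r)) (min ((2 * ve + vc - 2 * δ - r) - k) (ve - δ - r))
        else 0
      else 0 := by
  obtain ⟨y, s, hs, hk⟩ : ∃ y s : ℤ, (s = 0 ∨ s = 1) ∧ k + vb + r = 2 * y + s :=
    ⟨(k + vb + r) / 2, (k + vb + r) % 2, Int.emod_two_eq_zero_or_one _, by omega⟩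
  obtain rfl : vc = 2 * w + 1 - vb := by omega
  obtain rfl : k = 2 * y + s - vb - r := by omega
  have hn : n₀ = max 0 (y - w - r) := by
    rw [hn₀, show (2 * w + 1 - vb + r - (2 * y + s - vb - r)) / 2 = w + r - y by omega]
    congr 1
    ring
  clear hn₀ hk hw
  have e1 : 2 * y + s - vb - r - δ + vb = 2 * y + s - r - δ := by ring
  have e2 : 2 * y + s - vb - r + δ - (2 * w + 1 - vb) = 2 * y + s - r + δ - 2 * w - 1 := by ring
  have e3 : (2 * y + s - vb - r - (2 * w + 1 - vb) + 2 * δ + r) / 2 + 1 = y - w + δ + s := by omega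
  rw [hn, e1, e2, e3, toNat_add_toNat_eq_of_halves (y := y) hs hr hδ0 (show δ ≤ w by omega) hve]
  congr 1
  · exact if_congr (by omega) rfl rfl
  · rw [← ite_and]
    refine if_congr (by omega) ?_ rfl
    congr 1
    · ring
    · congr 1
      ring

theorem sum_zpow_eq_of_gt (X : ℂ) {vb vc ve r k δ : ℤ} (hodd : Odd (vb + vc))
    (hr : 0 ≤ r) (hδ0 : 0 ≤ δ) (hδ : 2 * δ < vb + vc) (hve : 0 ≤ ve) :
    ∑ n ∈ Finset.Icc 0 ve, (if k ≤ 2 * n + vc + r then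
      (if n - (k - n) ≤ 2 * δ + r - vc then X ^ (n - max 0 (-((vc + r - k) / 2)))
      else if n ≤ r + δ then (if n - (k - n) ≤ vb + r then X ^ n else 0)
      else ((if δ - vb ≤ k - n then 1 else 0) + (if vc - δ ≤ k - n then 1 else 0)) *
        X ^ (r + δ)) else 0) =
      ∑ j ∈ Finset.Icc 0 (nFun vb vc ve δ r k), X ^ j +
        (if k ∈ Finset.Icc (2 * δ - vb + r) (2 * ve + vc - 2 * δ - r) then
          (cFun vb vc ve δ r k : ℂ) * X ^ (δ + r) else 0) := by
  obtain ⟨w, hw⟩ := hodd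
  have hN : bigN vb vc ve r δ = min ve (min ((vb + vc - 1) / 2 + r) (δ + r)) := rfl
  set n₀ := max 0 (-((vc + r - k) / 2)) with hn₀
  -- `I₀` carries the exponents below δ + r. From n₀ + δ + r on, `I₁` counts the ball about the
  -- first root, including a possible last n at which the two balls have not separated. `I₂` starts
  -- just after separation and counts the ball about the second root.
  let I₀ := Finset.Icc n₀ (min ve (min (n₀ + δ + r - 1) ((k + vb + r) / 2)))
  let I₁ := Finset.Icc (n₀ + δ + r) (min ve (k - δ + vb))
  let I₂ := Finset.Icc (max n₀ ((k - vc + 2 * δ + r) / 2 + 1)) (min ve (k + δ - vc))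
  have hg : ∀ n ∈ Finset.Icc 0 ve, (if k ≤ 2 * n + vc + r then
      (if n - (k - n) ≤ 2 * δ + r - vc then X ^ (n - n₀)
      else if n ≤ r + δ then (if n - (k - n) ≤ vb + r then X ^ n else 0)
      else ((if δ - vb ≤ k - n then 1 else 0) + (if vc - δ ≤ k - n then 1 else 0)) *
        X ^ (r + δ)) else 0) =
      (if n ∈ I₀ then X ^ (n - n₀) else 0) + ((if n ∈ I₁ then X ^ (δ + r) else 0) +
        (if n ∈ I₂ then X ^ (δ + r) else 0)) := by
    intro n hn
    rw [Finset.mem_Icc] at hn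
    have m₀ : n ∈ I₀ ↔ n₀ ≤ n ∧ n ≤ ve ∧ n ≤ n₀ + δ + r - 1 ∧ n ≤ (k + vb + r) / 2 := by
      rw [Finset.mem_Icc, le_min_iff, le_min_iff]
    have m₁ : n ∈ I₁ ↔ n₀ + δ + r ≤ n ∧ n ≤ ve ∧ n ≤ k - δ + vb := by
      rw [Finset.mem_Icc, le_min_iff]
    have m₂ : n ∈ I₂ ↔ (n₀ ≤ n ∧ (k - vc + 2 * δ + r) / 2 + 1 ≤ n) ∧ n ≤ ve ∧ n ≤ k + δ - vc := by
      rw [Finset.mem_Icc, le_min_iff, max_le_iff]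
    simp only [m₀, m₁, m₂]
    by_cases c0 : k ≤ 2 * n + vc + r
    · rw [if_pos c0]
      by_cases c1 : n - (k - n) ≤ 2 * δ + r - vc
      · rw [if_pos c1]
        by_cases c2 : n ≤ n₀ + δ + r - 1
        · rw [if_pos (by omega), if_neg (by omega), if_neg (by omega)]
          ring
        · rw [if_neg (by omega), if_pos (by omega), if_neg (by omega),
            show n - n₀ = δ + r by omega]
          ring
      · rw [if_neg c1]
        by_cases c2 : n ≤ r + δ
        · rw [if_pos c2]
          by_cases c3 : n - (k - n) ≤ vb + r
          · rw [if_pos c3]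
            by_cases c4 : n ≤ n₀ + δ + r - 1
            · rw [if_pos (by omega), if_neg (by omega), if_neg (by omega),
                show n - n₀ = n by omega]
              ring
            · rw [if_neg (by omega), if_pos (by omega), if_neg (by omega),
                show n = δ + r by omega]
              ring
          · rw [if_neg c3, if_neg (by omega), if_neg (by omega), if_neg (by omega)]
            ring
        · rw [if_neg c2, if_neg (show ¬ (n₀ ≤ n ∧ n ≤ ve ∧ n ≤ n₀ + δ + r - 1 ∧
            n ≤ (k + vb + r) / 2) by omega), zero_add, add_mul, ite_mul, ite_mul, zero_mul, one_mul,
            add_comm r δ]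
          congr 1
          · exact if_congr (by omega) rfl rfl
          · exact if_congr (by omega) rfl rfl
    · rw [if_neg c0, if_neg (by omega), if_neg (by omega), if_neg (by omega)]
      ring
  have hsub : ∀ I : Finset ℤ, ∀ f : ℤ → ℂ, I ⊆ Finset.Icc 0 ve →
      ∑ n ∈ Finset.Icc 0 ve, (if n ∈ I then f n else 0) = ∑ n ∈ I, f n := by
    intro I f hI
    rw [Finset.sum_ite_mem, Finset.inter_eq_right.mpr hI]
  have hs₀ : I₀ ⊆ Finset.Icc 0 ve := Finset.Icc_subset_Icc (by omega) (by omega)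
  have hs₁ : I₁ ⊆ Finset.Icc 0 ve := Finset.Icc_subset_Icc (by omega) (by omega)
  have hs₂ : I₂ ⊆ Finset.Icc 0 ve := Finset.Icc_subset_Icc (by omega) (by omega)
  rw [Finset.sum_congr rfl hg, Finset.sum_add_distrib, Finset.sum_add_distrib,
    hsub I₀ (fun n => X ^ (n - n₀)) hs₀, hsub I₁ (fun _ => X ^ (δ + r)) hs₁,
    hsub I₂ (fun _ => X ^ (δ + r)) hs₂, Finset.sum_const, Finset.sum_const, ← add_smul,
    nsmul_eq_mul]
  have hshift : ∑ n ∈ I₀, X ^ (n - n₀) =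
      ∑ j ∈ Finset.Icc 0 (min (nFun vb vc ve δ r k) (δ + r - 1)), X ^ j := by
    refine Finset.sum_nbij' (fun n => n - n₀) (fun j => j + n₀) ?_ ?_ ?_ ?_ ?_
    · intro n hn
      rw [Finset.mem_Icc] at hn ⊢
      rw [nFun, hN]
      omega
    · intro j hj
      rw [Finset.mem_Icc, nFun, hN] at hj
      rw [Finset.mem_Icc]
      omega
    · intro n _
      ring
    · intro n _
      ring
    · intro n _
      rfl
  have htop : ∑ j ∈ Finset.Icc 0 (nFun vb vc ve δ r k), X ^ j =
      ∑ j ∈ Finset.Icc 0 (min (nFun vb vc ve δ r k) (δ + r - 1)), X ^ j +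
        if δ + r ≤ nFun vb vc ve δ r k then X ^ (δ + r) else 0 := by
    split_ifs with hc
    · have hle : nFun vb vc ve δ r k = δ + r := by
        rw [nFun, hN] at hc ⊢
        omega
      rw [hle, min_eq_right (by omega)]
      have : Finset.Icc 0 (δ + r) = insert (δ + r) (Finset.Icc 0 (δ + r - 1)) := by
        ext j
        rw [Finset.mem_insert, Finset.mem_Icc, Finset.mem_Icc]
        omega
      rw [this, Finset.sum_insert (by rw [Finset.mem_Icc]; omega), add_comm]
    · rw [min_eq_left (by omega), add_zero]
  have hcard : ((I₁.card + I₂.card : ℕ) : ℤ) = (if δ + r ≤ nFun vb vc ve δ r k then 1 else 0) +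
      if k ∈ Finset.Icc (2 * δ - vb + r) (2 * ve + vc - 2 * δ - r) then
        cFun vb vc ve δ r k else 0 := by
    rw [Nat.cast_add, Int.card_Icc, Int.card_Icc, nFun, hN, cFun]
    simp only [Finset.mem_Icc]
    exact toNat_add_toNat_eq hw hr hδ0 hδ hve hn₀
  have hcard' : ((I₁.card + I₂.card : ℕ) : ℂ) = (if δ + r ≤ nFun vb vc ve δ r k then 1 else 0) +
      if k ∈ Finset.Icc (2 * δ - vb + r) (2 * ve + vc - 2 * δ - r) then
        (cFun vb vc ve δ r k : ℂ) else 0 := by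
    have := congrArg (Int.cast : ℤ → ℂ) hcard
    push_cast at this ⊢
    exact this
  rw [hshift, htop, hcard', add_assoc, add_mul, ite_mul, ite_mul, one_mul, zero_mul]

end Combinatorics

/-! ### Invariance of the integrand and its values at representatives. -/

section Integrand

variable {F E : Type*} [NormedField F] [NormedField E] [NormedAlgebra F E] {ϖ : F}

theorem conj_mem_symmetricSpace {n : ℕ} {σ : E ≃ₐ[F] E} {γ : Matrix (Fin n) (Fin n) E}
    (hγ : γ ∈ symmetricSpace σ n) (h : GL (Fin n) F) :
    (h : Matrix (Fin n) (Fin n) F).map (algebraMap F E) * γ *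
      ((h⁻¹ : GL (Fin n) F) : Matrix (Fin n) (Fin n) F).map (algebraMap F E) ∈
        symmetricSpace σ n := by
  have hσ : ∀ A : Matrix (Fin n) (Fin n) F,
      (A.map (algebraMap F E)).map σ = A.map (algebraMap F E) := by
    intro A
    ext i j
    simp
  have h1 : ((h⁻¹ : GL (Fin n) F) : Matrix (Fin n) (Fin n) F).map (algebraMap F E) *
      (h : Matrix (Fin n) (Fin n) F).map (algebraMap F E) = 1 := by
    rw [← Matrix.map_mul, ← Units.val_mul, inv_mul_cancel, Units.val_one,
      Matrix.map_one _ (map_zero _) (map_one _)]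
  have h2 : (h : Matrix (Fin n) (Fin n) F).map (algebraMap F E) *
      ((h⁻¹ : GL (Fin n) F) : Matrix (Fin n) (Fin n) F).map (algebraMap F E) = 1 := by
    rw [← Matrix.map_mul, ← Units.val_mul, mul_inv_cancel, Units.val_one,
      Matrix.map_one _ (map_zero _) (map_one _)]
  have hγ' : γ * γ.map σ = 1 := hγ
  change _ * Matrix.map _ σ = 1
  rw [Matrix.map_mul, Matrix.map_mul, hσ, hσ]
  generalize (h : Matrix (Fin n) (Fin n) F).map (algebraMap F E) = A at *
  generalize ((h⁻¹ : GL (Fin n) F) : Matrix (Fin n) (Fin n) F).map (algebraMap F E) = B at *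
  calc A * γ * B * (A * γ.map σ * B) = A * γ * (B * A) * γ.map σ * B := by simp only [mul_assoc]
    _ = A * (γ * γ.map σ) * B := by rw [h1]; simp only [mul_assoc, mul_one]
    _ = 1 := by rw [hγ', mul_one, h2]

/-- The equations x σ(x) = 1 - y σ(z), with x diagonal and y, z off-diagonal, bound |x|² by
|ϖ|^(-2r); here r ≥ 0 absorbs the 1. -/
theorem mem_symmetricSpaceLE_two_iff [IsUltrametricDist E] (hϖ : IsUniformizer ϖ) {σ : E ≃ₐ[F] E}
    (hσ : ∀ x, ‖σ x‖ = ‖x‖) {a b c d : E} (h : !![a, b; c, d] ∈ symmetricSpace σ 2) (r : ℕ) :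
    !![a, b; c, d] ∈ symmetricSpaceLE σ 2 ϖ r ↔
      ‖b‖ ≤ ‖ϖ‖ ^ (-(r : ℤ)) ∧ ‖c‖ ≤ ‖ϖ‖ ^ (-(r : ℤ)) := by
  constructor
  · rintro ⟨-, h1⟩
    exact ⟨h1 0 1, h1 1 0⟩
  · rintro ⟨hb, hc⟩
    obtain ⟨e1, -, -, e2⟩ := mem_symmetricSpace_two.mp h
    have hone : 1 ≤ ‖ϖ‖ ^ (-(r : ℤ)) := by
      rw [← zpow_zero ‖ϖ‖, hϖ.zpow_le_zpow]
      omega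
    have key : ∀ x y z : E, x * σ x + y * σ z = 1 → ‖y‖ ≤ ‖ϖ‖ ^ (-(r : ℤ)) →
        ‖z‖ ≤ ‖ϖ‖ ^ (-(r : ℤ)) → ‖x‖ ≤ ‖ϖ‖ ^ (-(r : ℤ)) := by
      intro x y z hxyz hy hz
      have h1 : ‖x * σ x‖ ≤ ‖ϖ‖ ^ (-(r : ℤ)) * ‖ϖ‖ ^ (-(r : ℤ)) := by
        rw [show x * σ x = 1 - y * σ z by linear_combination hxyz]
        refine (norm_sub_le_max_of_ultrametric _ _).trans (max_le ?_ ?_)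
        · rw [norm_one]
          exact one_le_mul_of_one_le_of_one_le hone hone
        · rw [norm_mul, hσ]
          gcongr
      rw [norm_mul, hσ] at h1
      exact abs_le_of_sq_le_sq' (by simpa [sq] using h1) (zero_le_one.trans hone) |>.2
    refine ⟨h, fun i j => ?_⟩
    fin_cases i <;> fin_cases j
    exacts [key _ _ _ e1 hb hc, hb, hc, key d c b (by linear_combination e2) hc hb]

theorem norm_mul_apply_le_of_norm_le [IsUltrametricDist E] {n : ℕ} {A B : Matrix (Fin n) (Fin n) E}
    {R S : ℝ} (hR : 0 ≤ R) (hS : 0 ≤ S) (hA : ∀ i j, ‖A i j‖ ≤ R) (hB : ∀ i j, ‖B i j‖ ≤ S)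
    (i j : Fin n) : ‖(A * B) i j‖ ≤ R * S := by
  rw [Matrix.mul_apply]
  refine IsUltrametricDist.norm_sum_le_of_forall_le_of_nonneg (mul_nonneg hR hS) fun k _ => ?_
  rw [norm_mul]
  exact mul_le_mul (hA i k) (hB k j) (norm_nonneg _) hR

theorem conj_mem_symmetricSpaceLE [IsUltrametricDist E] {σ : E ≃ₐ[F] E}
    {γ : Matrix (Fin 2) (Fin 2) E} {r : ℕ} (hγ : γ ∈ symmetricSpaceLE σ 2 ϖ r)
    {k : GL (Fin 2) F} (hk : k ∈ integralGL F 2) :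
    (k : Matrix (Fin 2) (Fin 2) F).map (algebraMap F E) * γ *
      ((k⁻¹ : GL (Fin 2) F) : Matrix (Fin 2) (Fin 2) F).map (algebraMap F E) ∈
        symmetricSpaceLE σ 2 ϖ r := by
  refine ⟨conj_mem_symmetricSpace hγ.1 k, fun i j => ?_⟩
  have hR : 0 ≤ ‖ϖ‖ ^ (-(r : ℤ)) := zpow_nonneg (norm_nonneg _) _
  have h1 := norm_mul_apply_le_of_norm_le (A := (k : Matrix (Fin 2) (Fin 2) F).map (algebraMap F E))
    (B := γ) zero_le_one hR (fun i j => by rw [Matrix.map_apply, norm_algebraMap']; exact hk.1 i j)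
    hγ.2
  have h2 := norm_mul_apply_le_of_norm_le
    (B := ((k⁻¹ : GL (Fin 2) F) : Matrix (Fin 2) (Fin 2) F).map (algebraMap F E))
    (mul_nonneg zero_le_one hR) zero_le_one h1
    (fun i j => by rw [Matrix.map_apply, norm_algebraMap']; exact (integralGL_inv_mem hk).1 i j) i j
  simpa using h2

theorem conj_mem_symmetricSpaceLE_iff [IsUltrametricDist E] {σ : E ≃ₐ[F] E}
    {γ : Matrix (Fin 2) (Fin 2) E} {r : ℕ} {k : GL (Fin 2) F} (hk : k ∈ integralGL F 2) :
    (k : Matrix (Fin 2) (Fin 2) F).map (algebraMap F E) * γ *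
      ((k⁻¹ : GL (Fin 2) F) : Matrix (Fin 2) (Fin 2) F).map (algebraMap F E) ∈
        symmetricSpaceLE σ 2 ϖ r ↔ γ ∈ symmetricSpaceLE σ 2 ϖ r := by
  refine ⟨fun h => ?_, fun h => conj_mem_symmetricSpaceLE h hk⟩
  have := conj_mem_symmetricSpaceLE h (integralGL_inv_mem hk)
  have h1 : ((k⁻¹ : GL (Fin 2) F) : Matrix (Fin 2) (Fin 2) F).map (algebraMap F E) *
      (k : Matrix (Fin 2) (Fin 2) F).map (algebraMap F E) = 1 := by
    rw [← Matrix.map_mul, ← Units.val_mul, inv_mul_cancel, Units.val_one,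
      Matrix.map_one _ (map_zero _) (map_one _)]
  rw [inv_inv] at this
  generalize (k : Matrix (Fin 2) (Fin 2) F).map (algebraMap F E) = A at *
  generalize ((k⁻¹ : GL (Fin 2) F) : Matrix (Fin 2) (Fin 2) F).map (algebraMap F E) = B at *
  have e : B * (A * γ * B) * A = γ := by
    calc B * (A * γ * B) * A = (B * A) * γ * (B * A) := by simp only [mul_assoc]
      _ = γ := by rw [h1, one_mul, mul_one]
  rwa [e] at this

theorem norm_mulVec_le_one [IsUltrametricDist F] {k : GL (Fin 2) F} (hk : k ∈ integralGL F 2)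
    {u : Fin 2 → F} (hu : ∀ i, ‖u i‖ ≤ 1) (i : Fin 2) :
    ‖((k : Matrix (Fin 2) (Fin 2) F) *ᵥ u) i‖ ≤ 1 := by
  rw [Matrix.mulVec, dotProduct]
  refine IsUltrametricDist.norm_sum_le_of_forall_le_of_nonneg zero_le_one fun j _ => ?_
  rw [norm_mul]
  exact mul_le_one₀ (hk.1 i j) (norm_nonneg _) (hu j)

theorem norm_vecMul_le_one [IsUltrametricDist F] {k : GL (Fin 2) F} (hk : k ∈ integralGL F 2)
    {u : Fin 2 → F} (hu : ∀ i, ‖u i‖ ≤ 1) (i : Fin 2) :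
    ‖(u ᵥ* (k : Matrix (Fin 2) (Fin 2) F)) i‖ ≤ 1 := by
  rw [Matrix.vecMul, dotProduct]
  refine IsUltrametricDist.norm_sum_le_of_forall_le_of_nonneg zero_le_one fun j _ => ?_
  rw [norm_mul]
  exact mul_le_one₀ (hu j) (norm_nonneg _) (hk.1 j i)

theorem integralIndicator_conj [IsUltrametricDist F] {k : GL (Fin 2) F} (hk : k ∈ integralGL F 2)
    (u v : Fin 2 → F) :
    integralIndicator ((k : Matrix (Fin 2) (Fin 2) F) *ᵥ u)
      (v ᵥ* ((k⁻¹ : GL (Fin 2) F) : Matrix (Fin 2) (Fin 2) F)) = integralIndicator u v := by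
  have hk' := integralGL_inv_mem hk
  have h1 : (∀ i, ‖((k : Matrix (Fin 2) (Fin 2) F) *ᵥ u) i‖ ≤ 1) ↔ ∀ i, ‖u i‖ ≤ 1 := by
    refine ⟨fun h => ?_, norm_mulVec_le_one hk⟩
    have := norm_mulVec_le_one hk' h
    rwa [Matrix.mulVec_mulVec, ← Units.val_mul, inv_mul_cancel, Units.val_one,
      Matrix.one_mulVec] at this
  have h2 : (∀ i, ‖(v ᵥ* ((k⁻¹ : GL (Fin 2) F) : Matrix (Fin 2) (Fin 2) F)) i‖ ≤ 1) ↔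
      ∀ i, ‖v i‖ ≤ 1 := by
    refine ⟨fun h => ?_, norm_vecMul_le_one hk'⟩
    have := norm_vecMul_le_one hk h
    rwa [Matrix.vecMul_vecMul, ← Units.val_mul, inv_mul_cancel, Units.val_one,
      Matrix.vecMul_one] at this
  simp only [integralIndicator, h1, h2]

theorem ord_congr {x y : F} (h : ‖x‖ = ‖y‖) : ord ϖ x = ord ϖ y := by
  simp only [ord, h]

theorem normalizedAbs_congr {q : ℕ} {x y : F} (h : ‖x‖ = ‖y‖) :
    normalizedAbs q ϖ x = normalizedAbs q ϖ y := by
  have : x = 0 ↔ y = 0 := by rw [← norm_eq_zero, h, norm_eq_zero]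
  by_cases hx : x = 0
  · rw [normalizedAbs, normalizedAbs, if_pos hx, if_pos (this.mp hx)]
  · rw [normalizedAbs, normalizedAbs, if_neg hx, if_neg (hx ∘ this.mpr), ord_congr h]

/-- Each factor is separately invariant: conjugation by K preserves the truncated symmetric space, K
preserves the integral vectors, and |det| is unchanged. -/
theorem orbIntegrand_mul_left [IsUltrametricDist F] [IsUltrametricDist E] {σ : E ≃ₐ[F] E} (q : ℕ)
    (r : ℕ) (x : Matrix (Fin 2) (Fin 2) E × (Fin 2 → F) × (Fin 2 → F)) (s : ℂ)
    {k : GL (Fin 2) F} (hk : k ∈ integralGL F 2) (h : GL (Fin 2) F) :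
    orbIntegrand q ϖ ((symmetricSpaceLE σ 2 ϖ r).indicator 1) x s (k * h) =
      orbIntegrand q ϖ ((symmetricSpaceLE σ 2 ϖ r).indicator 1) x s h := by
  have hdet : ‖((k * h : GL (Fin 2) F) : Matrix (Fin 2) (Fin 2) F).det‖ =
      ‖(h : Matrix (Fin 2) (Fin 2) F).det‖ := by
    rw [Units.val_mul, Matrix.det_mul, norm_mul, hk.2, one_mul]
  have hφ : ((k * h : GL (Fin 2) F) : Matrix (Fin 2) (Fin 2) F).map (algebraMap F E) * x.1 *
      (((k * h)⁻¹ : GL (Fin 2) F) : Matrix (Fin 2) (Fin 2) F).map (algebraMap F E) =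
      (k : Matrix (Fin 2) (Fin 2) F).map (algebraMap F E) *
        ((h : Matrix (Fin 2) (Fin 2) F).map (algebraMap F E) * x.1 *
        ((h⁻¹ : GL (Fin 2) F) : Matrix (Fin 2) (Fin 2) F).map (algebraMap F E)) *
      ((k⁻¹ : GL (Fin 2) F) : Matrix (Fin 2) (Fin 2) F).map (algebraMap F E) := by
    rw [mul_inv_rev, Units.val_mul, Units.val_mul, Matrix.map_mul, Matrix.map_mul]
    simp only [mul_assoc]
  have hind : ∀ A B : Matrix (Fin 2) (Fin 2) E,
      (A ∈ symmetricSpaceLE σ 2 ϖ r ↔ B ∈ symmetricSpaceLE σ 2 ϖ r) →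
      (symmetricSpaceLE σ 2 ϖ r).indicator (1 : Matrix (Fin 2) (Fin 2) E → ℂ) A =
        (symmetricSpaceLE σ 2 ϖ r).indicator 1 B := by
    intro A B hAB
    classical
    simp only [Set.indicator_apply, hAB, Pi.one_apply]
  rw [orbIntegrand, orbIntegrand, normalizedAbs_congr hdet, eta, eta, ord_congr hdet, hφ,
    hind _ _ (conj_mem_symmetricSpaceLE_iff hk), mul_inv_rev, Units.val_mul, Units.val_mul,
    ← Matrix.mulVec_mulVec, ← Matrix.vecMul_vecMul, integralIndicator_conj hk]

theorem ofReal_zpow_neg_cpow_neg {q : ℕ} (hq : 0 < q) (k : ℤ) (s : ℂ) :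
    ((((q : ℝ) ^ (-k) : ℝ) : ℂ)) ^ (-s) = ((q : ℂ) ^ s) ^ k := by
  have hq' : (0 : ℝ) < q := by exact_mod_cast hq
  have hq0 : (q : ℂ) ≠ 0 := by exact_mod_cast hq.ne'
  have hne : (((q : ℝ) ^ (-k) : ℝ) : ℂ) ≠ 0 := by
    exact_mod_cast (zpow_pos hq' (-k)).ne'
  rw [← Complex.cpow_mul_int, Complex.cpow_def_of_ne_zero hne, Complex.cpow_def_of_ne_zero hq0,
    ← Complex.ofReal_log (zpow_pos hq' _).le, Real.log_zpow, ← Complex.natCast_log]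
  congr 1
  push_cast
  ring

/-- The integrand at a coset representative. -/
theorem orbIntegrand_rep [IsUltrametricDist F] [IsUltrametricDist E] (hϖ : IsUniformizer ϖ)
    {σ : E ≃ₐ[F] E} (hσ : ∀ x, ‖σ x‖ = ‖x‖) {q : ℕ} (hq : 0 < q) {a b c d : E} {e C D : F}
    {vb vc ve : ℤ} (hS : !![a, b; c, d] ∈ symmetricSpace σ 2) (hb : ‖b‖ = ‖ϖ‖ ^ vb)
    (hc : ‖c‖ = ‖ϖ‖ ^ vc) (he : ‖e‖ = ‖ϖ‖ ^ ve) (hC : c = b * algebraMap F E C)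
    (hD : d - a = b * algebraMap F E D) (r : ℕ) (s : ℂ) (m n : ℤ) (t : F) :
    ((‖t‖ ≤ 1 ∧ 0 ≤ n ∧ n ≤ ve ∧ m ≤ n + vc + r ∧
        ‖ϖ ^ m + t * D - t ^ 2 * C * (ϖ ^ m)⁻¹‖ ≤ ‖ϖ‖ ^ (n - r - vb)) →
      orbIntegrand q ϖ ((symmetricSpaceLE σ 2 ϖ r).indicator 1)
        (!![a, b; c, d], ![0, 1], ![0, e]) s (hϖ.rep m n t) =
        (-1 : ℂ) ^ (m + n) * ((q : ℂ) ^ s) ^ (m + n)) ∧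
    (¬ (‖t‖ ≤ 1 ∧ 0 ≤ n ∧ n ≤ ve ∧ m ≤ n + vc + r ∧
        ‖ϖ ^ m + t * D - t ^ 2 * C * (ϖ ^ m)⁻¹‖ ≤ ‖ϖ‖ ^ (n - r - vb)) →
      orbIntegrand q ϖ ((symmetricSpaceLE σ 2 ϖ r).indicator 1)
        (!![a, b; c, d], ![0, 1], ![0, e]) s (hϖ.rep m n t) = 0) := by
  have hp := hϖ.norm_pos
  have hm0 := zpow_ne_zero m hϖ.ne_zero
  have hn0 := zpow_ne_zero n hϖ.ne_zero
  set j := algebraMap F E with hj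
  have hjm : j (ϖ ^ m) ≠ 0 := (map_ne_zero j).mpr hm0
  have hjn : j (ϖ ^ n) ≠ 0 := (map_ne_zero j).mpr hn0
  -- The diagonal entries stay anonymous: membership in the truncated space depends only on the
  -- off-diagonal ones.
  obtain ⟨a', d', hconj⟩ : ∃ a' d' : E,
      (hϖ.rep m n t : Matrix (Fin 2) (Fin 2) F).map j * !![a, b; c, d] *
        (((hϖ.rep m n t)⁻¹ : GL (Fin 2) F) : Matrix (Fin 2) (Fin 2) F).map j =
      !![a', b * j ((ϖ ^ m + t * D - t ^ 2 * C * (ϖ ^ m)⁻¹) * (ϖ ^ n)⁻¹);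
        c * j (ϖ ^ n * (ϖ ^ m)⁻¹), d'] := by
    have e1 : (hϖ.rep m n t : Matrix (Fin 2) (Fin 2) F).map j = !![j (ϖ ^ m), j t; 0, j (ϖ ^ n)] := by
      rw [hϖ.coe_rep]
      ext i k
      fin_cases i <;> fin_cases k <;> simp
    have e2 : (((hϖ.rep m n t)⁻¹ : GL (Fin 2) F) : Matrix (Fin 2) (Fin 2) F).map j =
        !![(j (ϖ ^ m))⁻¹, -((j (ϖ ^ m))⁻¹ * j t * (j (ϖ ^ n))⁻¹); 0, (j (ϖ ^ n))⁻¹] := by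
      rw [hϖ.coe_inv_rep]
      ext i k
      fin_cases i <;> fin_cases k <;> simp
    have h01 : (j (ϖ ^ m) * a + j t * c) * -((j (ϖ ^ m))⁻¹ * j t * (j (ϖ ^ n))⁻¹) +
        (j (ϖ ^ m) * b + j t * d) * (j (ϖ ^ n))⁻¹ =
        b * j ((ϖ ^ m + t * D - t ^ 2 * C * (ϖ ^ m)⁻¹) * (ϖ ^ n)⁻¹) := by
      rw [map_mul, map_sub, map_add, map_mul j t D, map_mul, map_mul, map_inv₀, map_inv₀, map_pow,
        hC, show d = a + b * j D by rw [← hD]; ring]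
      field_simp
      ring
    have h10 : (0 * a + j (ϖ ^ n) * c) * (j (ϖ ^ m))⁻¹ + (0 * b + j (ϖ ^ n) * d) * 0 =
        c * j (ϖ ^ n * (ϖ ^ m)⁻¹) := by
      rw [map_mul, map_inv₀]
      ring
    rw [e1, e2, Matrix.mul_fin_two, Matrix.mul_fin_two, h01, h10]
    exact ⟨_, _, rfl⟩
  have hconjS := conj_mem_symmetricSpace hS (hϖ.rep m n t)
  rw [← hj, hconj] at hconjS
  have hmem := mem_symmetricSpaceLE_two_iff hϖ hσ hconjS r
  have hbc : ‖b * j ((ϖ ^ m + t * D - t ^ 2 * C * (ϖ ^ m)⁻¹) * (ϖ ^ n)⁻¹)‖ ≤ ‖ϖ‖ ^ (-(r : ℤ)) ↔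
      ‖ϖ ^ m + t * D - t ^ 2 * C * (ϖ ^ m)⁻¹‖ ≤ ‖ϖ‖ ^ (n - r - vb) := by
    rw [norm_mul, hj, norm_algebraMap', norm_mul, hb, norm_inv, norm_zpow,
      show (-(r : ℤ)) = vb + ((n - r - vb) + -n) by ring, zpow_add₀ hp.ne',
      zpow_add₀ hp.ne', mul_le_mul_iff_right₀ (zpow_pos hp _), zpow_neg,
      mul_le_mul_iff_left₀ (inv_pos.mpr (zpow_pos hp _))]
  have hcc : ‖c * j (ϖ ^ n * (ϖ ^ m)⁻¹)‖ ≤ ‖ϖ‖ ^ (-(r : ℤ)) ↔ m ≤ n + vc + r := by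
    rw [norm_mul, hj, norm_algebraMap', norm_mul, hc, norm_inv, norm_zpow, norm_zpow,
      ← zpow_neg, ← zpow_add₀ hp.ne', ← zpow_add₀ hp.ne', hϖ.zpow_le_zpow]
    omega
  rw [hbc, hcc] at hmem
  have hu : (hϖ.rep m n t : Matrix (Fin 2) (Fin 2) F) *ᵥ ![0, 1] = ![t, ϖ ^ n] := by
    rw [hϖ.coe_rep]
    ext i
    fin_cases i <;> simp [Matrix.mulVec, dotProduct]
  have hv : ![0, e] ᵥ* (((hϖ.rep m n t)⁻¹ : GL (Fin 2) F) : Matrix (Fin 2) (Fin 2) F) =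
      ![0, e * (ϖ ^ n)⁻¹] := by
    rw [hϖ.coe_inv_rep]
    ext i
    fin_cases i <;> simp [Matrix.vecMul, dotProduct]
  have hvn : ‖e * (ϖ ^ n)⁻¹‖ ≤ 1 ↔ n ≤ ve := by
    rw [norm_mul, he, norm_inv, norm_zpow, ← zpow_neg, ← zpow_add₀ hp.ne', hϖ.zpow_le_one]
    omega
  have hint : ((∀ i, ‖(![t, ϖ ^ n] : Fin 2 → F) i‖ ≤ 1) ∧
      ∀ i, ‖(![0, e * (ϖ ^ n)⁻¹] : Fin 2 → F) i‖ ≤ 1) ↔ ‖t‖ ≤ 1 ∧ 0 ≤ n ∧ n ≤ ve := by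
    rw [Fin.forall_fin_two, Fin.forall_fin_two, ← hvn, ← hϖ.zpow_le_one (m := n), ← norm_zpow]
    simp only [Matrix.cons_val_zero, Matrix.cons_val_one, norm_zero, zero_le_one, true_and,
      and_assoc]
  have hdet : (hϖ.rep m n t : Matrix (Fin 2) (Fin 2) F).det = ϖ ^ (m + n) := by
    rw [hϖ.coe_rep, Matrix.det_fin_two_of, zpow_add₀ hϖ.ne_zero]
    ring
  have hord : ord ϖ (ϖ ^ (m + n)) = m + n := ord_eq hϖ.ne_zero hϖ.norm_lt_one (norm_zpow _ _)
  have habs : normalizedAbs q ϖ (ϖ ^ (m + n)) = (q : ℝ) ^ (-(m + n)) := by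
    rw [normalizedAbs, if_neg (zpow_ne_zero _ hϖ.ne_zero), hord]
  rw [orbIntegrand]
  dsimp only
  rw [← hj, hconj, hu, hv, hdet, habs, eta, hord, ofReal_zpow_neg_cpow_neg hq, integralIndicator]
  classical
  rw [Set.indicator_apply]
  simp only [hint, hmem, Pi.one_apply]
  constructor
  · rintro ⟨h1, h2, h3, h4, h5⟩
    rw [if_pos ⟨h5, h4⟩, if_pos ⟨h1, h2, h3⟩, one_mul, one_mul]
  · intro hn
    by_cases c1 : ‖t‖ ≤ 1 ∧ 0 ≤ n ∧ n ≤ ve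
    · rw [if_neg (fun h => hn ⟨c1.1, c1.2.1, c1.2.2, h.2, h.1⟩), zero_mul, zero_mul, zero_mul]
    · rw [if_neg c1, mul_zero, zero_mul, zero_mul]

end Integrand

/-! ### The orbital integral as a finite sum. -/

section OrbitalIntegral

variable {F E : Type*} [NormedField F] [IsUltrametricDist F] [ProperSpace F] [NormedField E]
  [IsUltrametricDist E] [NormedAlgebra F E] {ϖ : F}

/-- The orbital integral as a finite sum of cardinalities of solution sets. -/
theorem orb_eq_sum_ncard (hϖ : IsUniformizer ϖ)
    [MeasurableSpace (GL (Fin 2) F)] [BorelSpace (GL (Fin 2) F)]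
    (μ : Measure (GL (Fin 2) F)) [μ.IsHaarMeasure] (hμ : μ (integralGL F 2) = 1)
    {σ : E ≃ₐ[F] E} (hσ : ∀ x, ‖σ x‖ = ‖x‖) {q : ℕ} (hq : 0 < q) {a b c d : E} {e C D : F}
    {vb vc ve : ℤ} (hS : !![a, b; c, d] ∈ symmetricSpace σ 2) (hb : ‖b‖ = ‖ϖ‖ ^ vb)
    (hc : ‖c‖ = ‖ϖ‖ ^ vc) (he : ‖e‖ = ‖ϖ‖ ^ ve) (hC : c = b * algebraMap F E C)
    (hD : d - a = b * algebraMap F E D) (hda : ‖d - a‖ ≤ 1) (r : ℕ) (s : ℂ) :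
    Integrable (orbIntegrand q ϖ ((symmetricSpaceLE σ 2 ϖ r).indicator 1)
      (!![a, b; c, d], ![0, 1], ![0, e]) s) μ ∧
    orb μ q ϖ ((symmetricSpaceLE σ 2 ϖ r).indicator 1) (!![a, b; c, d], ![0, 1], ![0, e]) s =
      ∑ k ∈ Finset.Icc (-(vb + r)) (2 * ve + vc + r), (-1 : ℂ) ^ k *
        (∑ n ∈ Finset.Icc 0 ve, if k ≤ 2 * n + vc + r then
          (((QuotientAddGroup.mk : F → F ⧸ fracIdeal ϖ n) ''
            {t : F | ‖t‖ ≤ 1 ∧ ‖ϖ ^ (k - n) + t * D - t ^ 2 * C * (ϖ ^ (k - n))⁻¹‖ ≤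
              ‖ϖ‖ ^ (n - r - vb)}).ncard : ℂ) else 0) * ((q : ℂ) ^ s) ^ k := by
  have hp := hϖ.norm_pos
  let S : ℤ × ℤ → Set F := fun i => {t | ‖t‖ ≤ 1 ∧ 0 ≤ i.2 ∧ i.2 ≤ ve ∧ i.1 ≤ i.2 + vc + r ∧
    ‖ϖ ^ i.1 + t * D - t ^ 2 * C * (ϖ ^ i.1)⁻¹‖ ≤ ‖ϖ‖ ^ (i.2 - r - vb)}
  let W : ℤ × ℤ → ℂ := fun i => (-1 : ℂ) ^ (i.1 + i.2) * ((q : ℂ) ^ s) ^ (i.1 + i.2)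
  -- Passage from (k, n) to (m, n), with k = m + n the valuation of the determinant.
  let g : ℤ × ℤ → ℤ × ℤ := fun i => (i.1 - i.2, i.2)
  have hg : Function.Injective g := by
    rintro ⟨k, n⟩ ⟨k', n'⟩ h
    simp only [g, Prod.mk.injEq] at h ⊢
    omega
  let T : Finset (ℤ × ℤ) :=
    ((Finset.Icc (-(vb + r)) (2 * ve + vc + r)) ×ˢ Finset.Icc 0 ve).map ⟨g, hg⟩
  have hb0 : 0 < ‖b‖ := by rw [hb]; exact zpow_pos hp _
  have hCn : ‖C‖ = ‖ϖ‖ ^ (vc - vb) := by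
    have := congrArg norm hC
    rw [norm_mul, norm_algebraMap', hc, hb, show vc = vb + (vc - vb) by ring, zpow_add₀ hp.ne'] at this
    exact (mul_left_cancel₀ (zpow_pos hp _).ne' this).symm
  have hDn : ‖D‖ ≤ ‖ϖ‖ ^ (-vb) := by
    rw [hD, norm_mul, norm_algebraMap', hb] at hda
    rw [zpow_neg, ← one_div, le_div_iff₀' (zpow_pos hp _)]
    exact hda
  -- Solve the quadratic expression for ϖ^m and multiply by ϖ^n: each remaining term is bounded by
  -- |ϖ|^(-(vb+r)), using integrality of t and of d - a, and m ≤ n + vc + r.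
  have hlow : ∀ i t, t ∈ S i → -(vb + r) ≤ i.1 + i.2 := by
    rintro ⟨m, n⟩ t ⟨h1, h2, h3, h4, h5⟩
    dsimp only at h2 h3 h4 h5 ⊢
    have hm0 := zpow_ne_zero m hϖ.ne_zero
    have hle : ‖ϖ ^ m * ϖ ^ n‖ ≤ ‖ϖ‖ ^ (-(vb + r)) := by
      rw [show ϖ ^ m * ϖ ^ n = (ϖ ^ m + t * D - t ^ 2 * C * (ϖ ^ m)⁻¹) * ϖ ^ n - (t * D * ϖ ^ n -
        t ^ 2 * (C * (ϖ ^ m)⁻¹ * ϖ ^ n)) by ring]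
      refine (norm_sub_le_max_of_ultrametric _ _).trans (max_le ?_
        ((norm_sub_le_max_of_ultrametric _ _).trans (max_le ?_ ?_)))
      · rw [norm_mul, norm_zpow]
        calc _ ≤ ‖ϖ‖ ^ (n - r - vb) * ‖ϖ‖ ^ n := by gcongr
          _ ≤ _ := by
            rw [← zpow_add₀ hp.ne', hϖ.zpow_le_zpow]
            omega
      · rw [norm_mul, norm_mul, norm_zpow]
        calc _ ≤ 1 * ‖ϖ‖ ^ (-vb) * ‖ϖ‖ ^ n := by gcongr
          _ ≤ _ := by
            rw [one_mul, ← zpow_add₀ hp.ne', hϖ.zpow_le_zpow]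
            omega
      · rw [norm_mul, norm_pow, norm_mul, norm_mul, norm_inv, norm_zpow, norm_zpow, hCn, ← zpow_neg,
          ← zpow_add₀ hp.ne', ← zpow_add₀ hp.ne']
        calc _ ≤ 1 ^ 2 * ‖ϖ‖ ^ (vc - vb + -m + n) := by gcongr
          _ ≤ _ := by
            rw [one_pow, one_mul, hϖ.zpow_le_zpow]
            omega
    rw [← zpow_add₀ hϖ.ne_zero, norm_zpow, hϖ.zpow_le_zpow] at hle
    exact hle
  have hT : ∀ i, i ∉ T → S i = ∅ := by
    rintro ⟨m, n⟩ hi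
    rw [Set.eq_empty_iff_forall_notMem]
    intro t ht
    refine hi ?_
    have h1 := hlow _ _ ht
    obtain ⟨-, h2, h3, h4, -⟩ := ht
    dsimp only at h1 h2 h3 h4
    rw [Finset.mem_map]
    refine ⟨(m + n, n), ?_, ?_⟩
    · rw [Finset.mem_product, Finset.mem_Icc, Finset.mem_Icc]
      dsimp only
      omega
    · simp [g]
  have hfin : ∀ i, ((QuotientAddGroup.mk : F → F ⧸ fracIdeal ϖ i.2) '' S i).Finite := by
    rintro ⟨m, n⟩
    by_cases hn : 0 ≤ n
    · refine (hϖ.finite_image_ball 0 hn).subset (Set.image_mono ?_)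
      intro t ht
      rw [Set.mem_ofPred_eq, sub_zero, zpow_zero]
      exact ht.1
    · have : S (m, n) = ∅ := by
        rw [Set.eq_empty_iff_forall_notMem]
        exact fun t ht => hn ht.2.1
      rw [this, Set.image_empty]
      exact Set.finite_empty
  have hrep := orbIntegrand_rep hϖ hσ hq hS hb hc he hC hD r s
  have main := hϖ.integral_eq_sum_ncard μ hμ _
    (fun k hk x => orbIntegrand_mul_left (σ := σ) q r (!![a, b; c, d], ![0, 1], ![0, e]) s hk x)
    T S W (fun i t ht => (hrep i.1 i.2 t).1 ht) (fun i t ht => (hrep i.1 i.2 t).2 ht) hT hfin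
  refine ⟨main.1, main.2.trans ?_⟩
  rw [Finset.sum_map, Finset.sum_product]
  refine Finset.sum_congr rfl fun k _ => ?_
  rw [Finset.mul_sum, Finset.sum_mul]
  refine Finset.sum_congr rfl fun n hn => ?_
  rw [Finset.mem_Icc] at hn
  change (-1 : ℂ) ^ (k - n + n) * ((q : ℂ) ^ s) ^ (k - n + n) *
    (((QuotientAddGroup.mk : F → F ⧸ fracIdeal ϖ n) '' S (k - n, n)).ncard : ℂ) = _
  rw [sub_add_cancel]
  split_ifs with hk
  · have : S (k - n, n) = {t : F | ‖t‖ ≤ 1 ∧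
        ‖ϖ ^ (k - n) + t * D - t ^ 2 * C * (ϖ ^ (k - n))⁻¹‖ ≤ ‖ϖ‖ ^ (n - r - vb)} := by
      ext t
      exact ⟨fun h => ⟨h.1, h.2.2.2.2⟩, fun h => ⟨h.1, hn.1, hn.2, by dsimp only; omega, h.2⟩⟩
    rw [this]
    ring
  · have : S (k - n, n) = ∅ := by
      rw [Set.eq_empty_iff_forall_notMem]
      intro t ht
      have := ht.2.2.2.1
      dsimp only at this
      omega
    rw [this, Set.image_empty, Set.ncard_empty]
    simp

/-- The evaluation of the sum of the cardinalities of the solution sets. -/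
theorem IsUniformizer.sum_ncard_quadratic_eq (h : IsUniformizer ϖ) (h2 : ‖(2 : F)‖ = 1) {C D : F}
    {vb vc ve : ℤ} {δ : WithTop ℤ} (hC : ‖C‖ = ‖ϖ‖ ^ (vc - vb)) (hodd : Odd (vb + vc))
    (hve : 0 ≤ ve)
    (hD : D = 0 ∧ δ = ⊤ ∨ ∃ δ' : ℤ, δ = δ' ∧ 0 ≤ δ' ∧ ‖D‖ = ‖ϖ‖ ^ (δ' - vb)) (r : ℕ) (s : ℂ) :
    ∑ k ∈ Finset.Icc (-(vb + r)) (2 * ve + vc + r), (-1 : ℂ) ^ k *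
      (∑ n ∈ Finset.Icc 0 ve, (if k ≤ 2 * n + vc + r then
        (((QuotientAddGroup.mk : F → F ⧸ fracIdeal ϖ n) ''
          {t : F | ‖t‖ ≤ 1 ∧ ‖ϖ ^ (k - n) + t * D - t ^ 2 * C * (ϖ ^ (k - n))⁻¹‖ ≤
            ‖ϖ‖ ^ (n - r - vb)}).ncard : ℂ) else 0)) *
        ((idealIndex ϖ : ℂ) ^ s) ^ k =
      mainSum (idealIndex ϖ) vb vc ve δ r s + extraSum (idealIndex ϖ) vb vc ve r s δ := by
  have hsmall : (D = 0 ∨ ∃ δ' : ℤ, ‖D‖ = ‖ϖ‖ ^ (δ' - vb) ∧ vb + vc < 2 * δ') →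
      (∀ δ' : ℤ, δ = δ' → vb + vc < 2 * δ') → ∀ k : ℤ,
      ∑ n ∈ Finset.Icc 0 ve, (if k ≤ 2 * n + vc + r then
        (((QuotientAddGroup.mk : F → F ⧸ fracIdeal ϖ n) ''
          {t : F | ‖t‖ ≤ 1 ∧ ‖ϖ ^ (k - n) + t * D - t ^ 2 * C * (ϖ ^ (k - n))⁻¹‖ ≤
            ‖ϖ‖ ^ (n - r - vb)}).ncard : ℂ) else 0) =
        ∑ j ∈ Finset.Icc 0 (nFun vb vc ve δ r k), (idealIndex ϖ : ℂ) ^ j := by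
    intro hD' hδ k
    rw [← sum_zpow_eq_of_lt (idealIndex ϖ : ℂ) hodd hδ]
    refine Finset.sum_congr rfl fun n hn => ?_
    rw [Finset.mem_Icc] at hn
    split_ifs with h1 h2
    · rw [h.ncard_quadratic_of_lt hC hodd hD' hn.1 (by omega), if_pos h2, sub_add_cancel]
    · rw [h.ncard_quadratic_of_lt hC hodd hD' hn.1 (by omega), if_neg h2]
    · rfl
  rcases hD with ⟨hD, rfl⟩ | ⟨δ', rfl, hδ0, hD⟩
  · simp only [hsmall (Or.inl hD) (fun δ' hδ => absurd hδ (WithTop.coe_ne_top.symm))]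
    exact (add_zero _).symm
  · by_cases hlt : vb + vc < 2 * δ'
    · simp only [hsmall (Or.inr ⟨δ', hD, hlt⟩) (fun δ'' hδ => by rwa [← WithTop.coe_inj.mp hδ])]
      have hextra : extraSum (idealIndex ϖ) vb vc ve r s δ' = 0 := by
        refine Finset.sum_eq_zero fun k _ => ?_
        rw [cFun, if_neg (by omega), Int.cast_zero, mul_zero, zero_mul, zero_mul]
      rw [hextra, add_zero]
      rfl
    -- Equality is excluded by parity.
    · have hgt : 2 * δ' < vb + vc := by
        obtain ⟨w, hw⟩ := hodd
        omega
      have hr : (0 : ℤ) ≤ r := Int.natCast_nonneg r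
      have hlarge : ∀ k : ℤ,
          ∑ n ∈ Finset.Icc 0 ve, (if k ≤ 2 * n + vc + r then
        (((QuotientAddGroup.mk : F → F ⧸ fracIdeal ϖ n) ''
          {t : F | ‖t‖ ≤ 1 ∧ ‖ϖ ^ (k - n) + t * D - t ^ 2 * C * (ϖ ^ (k - n))⁻¹‖ ≤
            ‖ϖ‖ ^ (n - r - vb)}).ncard : ℂ) else 0) =
          ∑ j ∈ Finset.Icc 0 (nFun vb vc ve δ' r k), (idealIndex ϖ : ℂ) ^ j +
            (if k ∈ Finset.Icc (2 * δ' - vb + r) (2 * ve + vc - 2 * δ' - r) then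
              (cFun vb vc ve δ' r k : ℂ) * (idealIndex ϖ : ℂ) ^ (δ' + r) else 0) := by
        intro k
        rw [← sum_zpow_eq_of_gt (idealIndex ϖ : ℂ) hodd hr hδ0 hgt hve]
        refine Finset.sum_congr rfl fun n hn => ?_
        rw [Finset.mem_Icc] at hn
        refine if_ctx_congr Iff.rfl (fun h1 => ?_) fun _ => rfl
        rw [h.ncard_quadratic_of_gt h2 hC hD hgt hδ0 hr hn.1 (by omega), sub_add_cancel]
      have hsub : Finset.Icc (2 * δ' - vb + r) (2 * ve + vc - 2 * δ' - r) ⊆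
          Finset.Icc (-(vb + r)) (2 * ve + vc + r) :=
        Finset.Icc_subset_Icc (by omega) (by omega)
      have hextra : extraSum (idealIndex ϖ) vb vc ve r s δ' =
          ∑ k ∈ Finset.Icc (-(vb + r)) (2 * ve + vc + r),
            if k ∈ Finset.Icc (2 * δ' - vb + r) (2 * ve + vc - 2 * δ' - r) then
              (-1 : ℂ) ^ k * (cFun vb vc ve δ' r k : ℂ) * (idealIndex ϖ : ℂ) ^ (δ' + r) *
                ((idealIndex ϖ : ℂ) ^ s) ^ k else 0 := by
        rw [Finset.sum_ite_mem, Finset.inter_eq_right.mpr hsub]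
        rfl
      rw [hextra, mainSum, ← Finset.sum_add_distrib]
      refine Finset.sum_congr rfl fun k _ => ?_
      rw [hlarge]
      split_ifs <;> ring

end OrbitalIntegral

/-! ### Valuations on the minus locus. -/

section MinusLocus

variable {p : ℕ} [Fact p.Prime] {F E : Type*} [NormedField F] [NormedAlgebra ℚ_[p] F]
  [IsUltrametricDist F] [ProperSpace F] [NormedField E] [IsUltrametricDist E] [NormedAlgebra F E]

/-- The shape of the elements of the minus locus. -/
theorem exists_valuations_of_mem_minusLocus (hp : 2 < p) {ϖ : ringOfIntegers p F}
    (h : IsUniformizer (ϖ : F)) (hE : Module.finrank F E = 2) (hunr : IsUnramifiedExtension F E)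
    (σ : E ≃ₐ[F] E) (hσ : σ ≠ 1) (hσn : ∀ x, ‖σ x‖ = ‖x‖) {a b c d : E} {e : F}
    (hx : ((!![a, b; c, d], ![0, 1], ![0, e]) :
      Matrix (Fin 2) (Fin 2) E × (Fin 2 → F) × (Fin 2 → F)) ∈ minusLocus σ 2) :
    !![a, b; c, d] ∈ symmetricSpace σ 2 ∧ e ≠ 0 ∧ ∃ (C D : F) (vb vc : ℤ),
      ‖b‖ = ‖(ϖ : F)‖ ^ vb ∧ ‖c‖ = ‖(ϖ : F)‖ ^ vc ∧ Odd (vb + vc) ∧ 0 < vb + vc ∧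
      c = b * algebraMap F E C ∧ d - a = b * algebraMap F E D ∧ ‖d - a‖ ≤ 1 := by
  have hpos := h.norm_pos
  have hinv := algEquiv_involutive hE σ hσ
  have h2 : (2 : E) ≠ 0 := by
    have : ‖(2 : E)‖ = 1 := by
      rw [← norm_two_eq_one (F := F) hp, ← norm_algebraMap' E (2 : F), map_ofNat]
    exact norm_pos_iff.mp (by rw [this]; exact one_pos)
  obtain ⟨hS, hb, hc, he, hns⟩ := mul_conj_ne_of_mem_minusLocus σ hinv h2 hx
  obtain ⟨e1, e2, e3, e4⟩ := mem_symmetricSpace_two.mp hS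
  have hσb : σ b ≠ 0 := by simpa using hb
  have hval : ∀ x : E, x ≠ 0 → ∃ n : ℤ, ‖x‖ = ‖(ϖ : F)‖ ^ n := by
    intro x hx
    obtain ⟨y, hy⟩ := hunr x
    have hy0 : y ≠ 0 := norm_pos_iff.mp (by rw [← hy]; exact norm_pos_iff.mpr hx)
    obtain ⟨n, hn⟩ := h.exists_zpow y hy0
    exact ⟨n, hy.trans hn⟩
  obtain ⟨vb, hvb⟩ := hval b hb
  obtain ⟨vc, hvc⟩ := hval c hc
  -- Subtracting an entry of γ σ(γ) = 1 from its conjugate shows that c/b is fixed by σ; the next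
  -- step does the same for (d - a)/b.
  have hbc : σ c * b = c * σ b := by
    have := congrArg σ e1
    simp only [map_add, map_mul, hinv, map_one] at this
    linear_combination e1 - this
  have hda : σ (d - a) * b = (d - a) * σ b := by
    have := congrArg σ e2
    simp only [map_add, map_mul, hinv, map_zero] at this
    rw [map_sub]
    linear_combination e2 - this
  have hfix : ∀ x : E, σ x * b = x * σ b → ∃ y : F, x = b * algebraMap F E y := by
    intro x hx
    obtain ⟨y, hy⟩ := exists_algebraMap_eq_of_fixed hE σ hσ (x := x / b) (by
      rw [map_div₀, div_eq_div_iff hσb hb, hx])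
    exact ⟨y, by rw [hy, mul_div_cancel₀ _ hb]⟩
  obtain ⟨C, hC⟩ := hfix c hbc
  obtain ⟨D, hD⟩ := hfix (d - a) hda
  have hodd : Odd (vb + vc) := by
    by_contra heven
    rw [Int.not_odd_iff_even] at heven
    obtain ⟨w, hw⟩ := heven
    obtain ⟨y, hy⟩ := exists_algebraMap_eq_of_fixed hE σ hσ (x := -(c * σ b)) (by
      rw [map_neg, map_mul, hinv, hbc])
    obtain ⟨z, hz⟩ := exists_mul_conj_eq hp h hE hunr σ hσ (x := y) (k := w) (by
      rw [← norm_algebraMap' E y, hy, norm_neg, norm_mul, hσn, hvb, hvc, ← zpow_add₀ hpos.ne']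
      congr 1
      omega)
    exact hns z (hz.trans hy)
  have hcb : ‖c * σ b‖ = ‖(ϖ : F)‖ ^ (vb + vc) := by
    rw [norm_mul, hσn, hvb, hvc, ← zpow_add₀ hpos.ne', add_comm]
  -- If the odd number vb + vc were negative, then d σ(d) = 1 - c σ(b) would have odd valuation,
  -- whereas v(d σ(d)) = 2v(d).
  have hvpos : 0 < vb + vc := by
    by_contra hneg
    obtain ⟨w, hw⟩ := hodd
    have h1 : ‖d * σ d‖ = ‖(ϖ : F)‖ ^ (vb + vc) := by
      have hlt : ‖(1 : E)‖ < ‖-(c * σ b)‖ := by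
        rw [norm_one, norm_neg, hcb, ← zpow_zero ‖(ϖ : F)‖, h.zpow_lt_zpow]
        omega
      rw [show d * σ d = 1 + -(c * σ b) by linear_combination e4,
        IsUltrametricDist.norm_add_eq_max_of_norm_ne_norm hlt.ne, max_eq_right hlt.le, norm_neg, hcb]
    have hd : d ≠ 0 := by
      rintro rfl
      rw [zero_mul, norm_zero] at h1
      exact (zpow_pos hpos _).ne h1
    obtain ⟨u, hu⟩ := hval d hd
    rw [norm_mul, hσn, hu, ← zpow_add₀ hpos.ne', h.zpow_inj] at h1
    omega
  have hle : ∀ x y : E, x * σ x = 1 - y → ‖y‖ ≤ 1 → ‖x‖ ≤ 1 := by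
    intro x y hxy hy
    have h1 : ‖x * σ x‖ ≤ 1 := by
      rw [hxy]
      exact (norm_sub_le_max_of_ultrametric _ _).trans (max_le norm_one.le hy)
    rw [norm_mul, hσn, ← sq] at h1
    exact (sq_le_one_iff₀ (norm_nonneg x)).mp h1
  have hcb1 : ‖c * σ b‖ ≤ 1 := by
    rw [hcb, h.zpow_le_one]
    exact hvpos.le
  refine ⟨hS, he, C, D, vb, vc, hvb, hvc, hodd, hvpos, hC, hD,
    (norm_sub_le_max_of_ultrametric _ _).trans (max_le ?_ ?_)⟩
  · exact hle d (c * σ b) (by linear_combination e4) hcb1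
  · exact hle a (c * σ b) (by linear_combination e1 - hbc) hcb1

end MinusLocus

end SemiLie

/-! ### The explicit formula. -/

theorem mainTheorem2 {p : ℕ} [Fact p.Prime] (hp : 2 < p)
    {F E : Type*} [NormedField F] [NormedAlgebra ℚ_[p] F] [FiniteDimensional ℚ_[p] F]
    [NormedField E] [NormedAlgebra F E] (hE : Module.finrank F E = 2)
    (hunr : SemiLie.IsUnramifiedExtension F E)
    (σ : E ≃ₐ[F] E) (hσ : σ ≠ 1)
    (ϖ : SemiLie.ringOfIntegers p F) (hϖ : Irreducible ϖ)
    [MeasurableSpace (GL (Fin 2) F)] [BorelSpace (GL (Fin 2) F)]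
    (μ : Measure (GL (Fin 2) F)) [μ.IsHaarMeasure] (hμ : μ (SemiLie.integralGL F 2) = 1)
    (a b c d : E) (e : F)
    (hx : ((!![a, b; c, d], ![0, 1], ![0, e]) :
      Matrix (Fin 2) (Fin 2) E × (Fin 2 → F) × (Fin 2 → F)) ∈ SemiLie.minusLocus σ 2)
    (r : ℕ) :
    let q : ℕ := SemiLie.residueCard p F ϖ
    let x : Matrix (Fin 2) (Fin 2) E × (Fin 2 → F) × (Fin 2 → F) :=
      (!![a, b; c, d], ![0, 1], ![0, e])
    let φ : Matrix (Fin 2) (Fin 2) E → ℂ :=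
      (SemiLie.symmetricSpaceLE σ 2 (ϖ : F) r).indicator 1
    let vb : ℤ := SemiLie.ord (ϖ : F) b
    let vc : ℤ := SemiLie.ord (ϖ : F) c
    let ve : ℤ := SemiLie.ord (ϖ : F) e
    let δ : WithTop ℤ := SemiLie.val (ϖ : F) (d - a)
    (∀ s : ℂ, Integrable (SemiLie.orbIntegrand q (ϖ : F) φ x s) μ) ∧
    ((ve < 0 ∨ vb + vc < -2 * (r : ℤ)) →
      ∀ s : ℂ, SemiLie.orb μ q (ϖ : F) φ x s = 0) ∧
    (¬ (ve < 0 ∨ vb + vc < -2 * (r : ℤ)) →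
      ∀ s : ℂ, SemiLie.orb μ q (ϖ : F) φ x s =
        SemiLie.mainSum q vb vc ve δ r s + SemiLie.extraSum q vb vc ve r s δ) := by
  open SemiLie in
  intro q x φ vb vc ve δ
  have hultF : IsUltrametricDist F := IsUltrametricDist.of_normedAlgebra (L := F) ℚ_[p]
  have hultE : IsUltrametricDist E := IsUltrametricDist.of_normedAlgebra (L := E) F
  have hproper : ProperSpace F := FiniteDimensional.proper ℚ_[p] F
  have hfd : FiniteDimensional F E := Module.finite_of_finrank_eq_succ hE
  have h := isUniformizer_of_irreducible hϖ
  have hσn := norm_algEquiv_apply h σ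
  have hq : q = idealIndex (ϖ : F) := residueCard_eq_relIndex h
  have hqpos : 0 < q := hq ▸ h.relIndex_pos
  obtain ⟨hS, he0, C, D, vb', vc', hb, hc, hodd, hpos, hC, hD, hda⟩ :=
    exists_valuations_of_mem_minusLocus hp h hE hunr σ hσ hσn hx
  obtain rfl : vb = vb' := ord_eq h.ne_zero h.norm_lt_one hb
  obtain rfl : vc = vc' := ord_eq h.ne_zero h.norm_lt_one hc
  have he : ‖e‖ = ‖(ϖ : F)‖ ^ ve := by
    obtain ⟨n, hn⟩ := h.exists_zpow e he0
    exact h.norm_eq_ord hn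
  have hp0 := h.norm_pos
  have hCn : ‖C‖ = ‖(ϖ : F)‖ ^ (vc - vb) := by
    have := congrArg norm hC
    rw [norm_mul, norm_algebraMap', hc, hb, show vc = vb + (vc - vb) by ring, zpow_add₀ hp0.ne'] at this
    exact (mul_left_cancel₀ (zpow_pos hp0 _).ne' this).symm
  have hsum := orb_eq_sum_ncard h μ hμ hσn hqpos hS hb hc he hC hD hda r
  refine ⟨fun s => (hsum s).1, ?_, ?_⟩
  · rintro (hve | hv) s
    · rw [(hsum s).2]
      refine Finset.sum_eq_zero fun k _ => ?_
      rw [Finset.Icc_eq_empty (by omega), Finset.sum_empty, mul_zero, zero_mul]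
    -- On the minus locus vb + vc is positive, so this alternative never occurs.
    · omega
  intro hneg s
  push Not at hneg
  rw [(hsum s).2, hq]
  refine h.sum_ncard_quadratic_eq (norm_two_eq_one hp) hCn hodd hneg.1 ?_ r s
  by_cases hD0 : D = 0
  · have hda0 : d - a = 0 := by rw [hD, hD0, map_zero, mul_zero]
    exact Or.inl ⟨hD0, if_pos hda0⟩
  · obtain ⟨n, hn⟩ := h.exists_zpow D hD0
    have hdan : ‖d - a‖ = ‖(ϖ : F)‖ ^ (vb + n) := by
      rw [hD, norm_mul, norm_algebraMap', hb, hn, zpow_add₀ hp0.ne']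
    have hda0 : d - a ≠ 0 := norm_pos_iff.mp (by rw [hdan]; exact zpow_pos hp0 _)
    refine Or.inr ⟨vb + n, ?_, ?_, ?_⟩
    · exact (if_neg hda0).trans (congrArg _ (ord_eq h.ne_zero h.norm_lt_one hdan))
    · rwa [hdan, h.zpow_le_one] at hda
    · rw [hn]
      congr 1
      ring
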